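/- Let $n\ge 1$. For a measurable function $f:\mathbb R^n\to\mathbb C$ write $\|f\|$ for its $L^2(\mathbb R^n)$-norm and $\|f\|_{1,1}=\int_{\mathbb R^n}(1+|x|)|f(x)|\,dx$; let $L^{1,1}(\mathbb R^n)$ be the space of $f\in L^1(\mathbb R^n)$ with $\|f\|_{1,1}<\infty$. For $t>0$ let $G(t,x)=(4\pi t)^{-n/2}e^{-|x|^2/(4t)}$ be the Gauss kernel. There is a constant $C>0$ depending only on $n$ such that the following holds. Let $u_0\in H^1(\mathbb R^n)\cap L^{1,1}(\mathbb R^n)$ and $u_1\in L^2(\mathbb R^n)\cap L^{1,1}(\mathbb R^n)$ be complex-valued (in particular, real-valued functions are allowed), and let $u\in C([0,\infty);H^1(\mathbb R^n))\cap C^1([0,\infty);L^2(\mathbb R^n))$ be the weak solution of the Cauchy problem $$u_{tt}-\Delta u+u_t=0\ \text{ in }(0,\infty)\times\mathbb R^n,\qquad u(0,x)=u_0(x),\quad u_t(0,x)=u_1(x),$$ that is, $u(0)=u_0$, $u_t(0)=u_1$, and for every Schwartz function $\varphi$ on $\mathbb R^n$ and every $t>0$ $$\frac{d}{dt}\int_{\mathbb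 R^n}u_t\,\varphi\,dx+\int_{\mathbb R^n}\nabla u\cdot\nabla\varphi\,dx+\int_{\mathbb R^n}u_t\,\varphi\,dx=0 .$$ Then, with $P_{0j}=\int_{\mathbb R^n}u_j(x)\,dx$ for $j=0,1$, $$\|u(t,\cdot)-(P_{00}+P_{01})G(t,\cdot)\|\le C\,t^{-\frac n4-\frac12}\bigl(\|u_0\|_{1,1}+\|u_1\|_{1,1}+\|u_0\|+\|\nabla u_0\|+\|u_1\|\bigr)\qquad\text{for all }t>0 .$$ -/

import Mathlib

open MeasureTheory Set
open scoped SchwartzMap ENNReal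

noncomputable section

namespace DampedWave

/-- The Euclidean space `ℝⁿ`. -/
abbrev Space (n : ℕ) : Type := EuclideanSpace ℝ (Fin n)

/-- `L²(ℝⁿ)`, complex valued. -/
abbrev L2 (n : ℕ) : Type := Lp ℂ 2 (volume : Measure (Space n))

/-- `L²(ℝⁿ; ℂⁿ)`, with the Euclidean norm on `ℂⁿ`. -/
abbrev L2Vec (n : ℕ) : Type :=
  Lp (EuclideanSpace ℂ (Fin n)) 2 (volume : Measure (Space n))

/-- The partial derivative `∂φ/∂xⱼ` of a test function. -/
def partialDeriv {n : ℕ} (j : Fin n) (φ : 𝓢(Space n, ℂ)) (x : Space n) : ℂ :=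
  fderiv ℝ φ x (EuclideanSpace.single j 1)

/-- `g` is the gradient of `f` in the sense of (tempered) distributions. -/
def IsWeakGradient {n : ℕ} (f : L2 n) (g : L2Vec n) : Prop :=
  ∀ (j : Fin n) (φ : 𝓢(Space n, ℂ)),
    ∫ x, f x * partialDeriv j φ x = -∫ x, g x j * φ x

/-- The Sobolev space `H¹(ℝⁿ)`: an `L²` function together with its (unique) weak gradient,
which is required to lie in `L²`. The topology is that of `L² × L²`, i.e. the one of the
`H¹` norm: `uₖ → u` iff `uₖ → u` and `∇uₖ → ∇u` in `L²`. -/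
abbrev H1 (n : ℕ) : Type := {p : L2 n × L2Vec n // IsWeakGradient p.1 p.2}

/-- The underlying `L²` function of an element of `H¹`. -/
def H1.toL2 {n : ℕ} (u : H1 n) : L2 n := u.1.1

/-- The weak gradient of an element of `H¹`. -/
def H1.grad {n : ℕ} (u : H1 n) : L2Vec n := u.1.2

/-- Membership in the weighted space `L^{1,k}(ℝⁿ)`. -/
def MemWeightedL1 {n : ℕ} (k : ℕ) (f : Space n → ℂ) : Prop :=
  Integrable f ∧ Integrable (fun x => (1 + ‖x‖) ^ k * ‖f x‖)

/-- The norm `‖f‖_{1,k} = ∫ (1 + |x|)^k |f(x)| dx`. -/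
def weightedL1Norm {n : ℕ} (k : ℕ) (f : Space n → ℂ) : ℝ :=
  ∫ x, (1 + ‖x‖) ^ k * ‖f x‖

/-- The Gauss kernel `G(t,x) = (4πt)^{-n/2} exp(-|x|²/(4t))`. -/
def gaussKernel {n : ℕ} (t : ℝ) (x : Space n) : ℝ :=
  1 / (Real.sqrt (4 * Real.pi * t)) ^ n * Real.exp (-‖x‖ ^ 2 / (4 * t))

/-- `u` is a weak solution on `[0,∞) × ℝⁿ`, in the class
`C([0,∞); H¹) ∩ C¹([0,∞); L²)`, of
`u_tt - Δu + u_t = 0`, `u(0) = u₀`, `u_t(0) = u₁`.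
Here `v` is the time derivative `u_t`, and the equation reads
`d/dt ⟨u_t, φ⟩ + ⟨∇u, ∇φ⟩ + ⟨u_t, φ⟩ = 0` for `t > 0` and every test function `φ` on `ℝⁿ`.
Values of `u` at negative times play no role. -/
def IsWeakSolution {n : ℕ} (u₀ : H1 n) (u₁ : L2 n) (u : ℝ → H1 n) : Prop :=
  ContinuousOn u (Ici 0) ∧ u 0 = u₀ ∧
  ∃ v : ℝ → L2 n,
    ContinuousOn v (Ici 0) ∧
    (∀ t ∈ Ici (0 : ℝ), HasDerivWithinAt (fun s => (u s).toL2) (v t) (Ici 0) t) ∧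
    v 0 = u₁ ∧
    ∀ φ : 𝓢(Space n, ℂ), ∀ t : ℝ, 0 < t →
      HasDerivAt (fun s => ∫ x, v s x * φ x)
        (-(∫ x, ∑ j : Fin n, (u t).grad x j * partialDeriv j φ x) - ∫ x, v t x * φ x) t

end DampedWave

end

/-! Under the Fourier transform each frequency carries a damped oscillator `U'' + U' + aU = 0` with
`a = 4π²|ξ|²`, and the Gauss kernel becomes `exp(-at)`. By Plancherel the difference is estimated in
frequency, split at `a = 1/8`.

For `a ≤ 1/8` the characteristic roots are `-ρ` and `-(1-ρ)` with `ρ(1-ρ) = a` (`low_formula`). The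
fast mode decays exponentially. In the slow mode `ρ - a = ρ²`, so `exp(-tρ)` differs from `exp(-ta)`
by at most `ρ²t exp(-ta)`, while the first moment of the data makes their transforms differ from the
masses by `O(|ξ|)` (`norm_fourier_sub_integral_le`). Part of `exp(-at)` absorbs the resulting powers
of `|ξ|√t`, leaving `t^(-1/2) exp(-at/4)` (`low_frequency_bound`), whose `L²` norm is of order
`t^(-n/4-1/2)` (`eLpNorm_exp_symbol_le`).

For `a > 1/8` an energy with a cross term decays exponentially (`damped_system_decay`,
`high_decay`), and an exponential is dominated by any negative power of `t` (`exp_le_mul_rpow`).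
Since `a` is unbounded, the weak equation gives an ODE in `L²` only after multiplication by decaying
weights (`exists_fourier`). -/

noncomputable section

namespace DampedWave

/-! ### Bounded multipliers on `L²` and their exponentials -/

section Multiplier

variable {α : Type*} [MeasurableSpace α] {μ : Measure α}

/-- A measurable function that is bounded everywhere, used as a multiplier on `L²`. -/
def BddMeasurable (m : α → ℝ) : Prop := Measurable m ∧ ∃ K, ∀ x, |m x| ≤ K

lemma BddMeasurable.mul {m k : α → ℝ} (hm : BddMeasurable m) (hk : BddMeasurable k) :
    BddMeasurable (fun x => m x * k x) := by
  obtain ⟨hm, K, hK⟩ := hm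
  obtain ⟨hk, L, hL⟩ := hk
  refine ⟨hm.mul hk, K * L, fun x => ?_⟩
  rw [abs_mul]
  exact mul_le_mul (hK x) (hL x) (abs_nonneg _) ((abs_nonneg _).trans (hK x))

lemma BddMeasurable.add {m k : α → ℝ} (hm : BddMeasurable m) (hk : BddMeasurable k) :
    BddMeasurable (fun x => m x + k x) := by
  obtain ⟨hm, K, hK⟩ := hm
  obtain ⟨hk, L, hL⟩ := hk
  exact ⟨hm.add hk, K + L, fun x => (abs_add_le _ _).trans (add_le_add (hK x) (hL x))⟩

lemma BddMeasurable.const_mul {m : α → ℝ} (c : ℝ) (hm : BddMeasurable m) :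
    BddMeasurable (fun x => c * m x) :=
  BddMeasurable.mul ⟨measurable_const, |c|, fun _ => le_rfl⟩ hm

lemma BddMeasurable.exp {m : α → ℝ} (hm : BddMeasurable m) :
    BddMeasurable (fun x => Real.exp (m x)) := by
  obtain ⟨hm, K, hK⟩ := hm
  refine ⟨Real.measurable_exp.comp hm, Real.exp K, fun x => ?_⟩
  rw [abs_of_pos (Real.exp_pos _)]
  exact Real.exp_le_exp.2 ((le_abs_self _).trans (hK x))

lemma BddMeasurable.memLp_mul {m : α → ℝ} (hm : BddMeasurable m) (f : Lp ℂ 2 μ) :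
    MemLp (fun x => (m x : ℂ) * f x) 2 μ := by
  obtain ⟨hm, K, hK⟩ := hm
  refine MemLp.of_le_mul (c := K) (Lp.memLp f) ?_ (Filter.Eventually.of_forall fun x => ?_)
  · exact (Complex.measurable_ofReal.comp hm).aestronglyMeasurable.mul
      (Lp.memLp f).aestronglyMeasurable
  · rw [norm_mul, Complex.norm_real, Real.norm_eq_abs]
    exact mul_le_mul_of_nonneg_right (hK x) (norm_nonneg _)

lemma norm_toLp_mul_le {m : α → ℝ} (hm : BddMeasurable m) {K : ℝ} (hK : ∀ x, |m x| ≤ K)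
    (f : Lp ℂ 2 μ) : ‖(hm.memLp_mul f).toLp‖ ≤ K * ‖f‖ := by
  refine Lp.norm_le_mul_norm_of_ae_le_mul ?_
  filter_upwards [(hm.memLp_mul f).coeFn_toLp] with x hx
  rw [hx, norm_mul, Complex.norm_real, Real.norm_eq_abs]
  exact mul_le_mul_of_nonneg_right (hK x) (norm_nonneg _)

open Classical in
/-- Multiplication by a bounded measurable function, as an operator on `L²`. -/
def mulOp (m : α → ℝ) : Lp ℂ 2 μ →L[ℝ] Lp ℂ 2 μ :=
  -- The junk value 0 lets multipliers be written as bare functions; boundedness is supplied lemma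
  -- by lemma.
  if hm : BddMeasurable m then
    LinearMap.mkContinuousOfExistsBound
      { toFun := fun f => (hm.memLp_mul f).toLp
        map_add' := fun f g => by
          apply Lp.ext
          filter_upwards [(hm.memLp_mul (f + g)).coeFn_toLp, (hm.memLp_mul f).coeFn_toLp,
            (hm.memLp_mul g).coeFn_toLp, Lp.coeFn_add f g,
            Lp.coeFn_add (hm.memLp_mul f).toLp (hm.memLp_mul g).toLp] with x h1 h2 h3 h4 h5
          rw [h1, h5, Pi.add_apply, h2, h3, h4, Pi.add_apply, mul_add]
        map_smul' := fun c f => by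
          apply Lp.ext
          filter_upwards [(hm.memLp_mul (c • f)).coeFn_toLp, (hm.memLp_mul f).coeFn_toLp,
            Lp.coeFn_smul c f, Lp.coeFn_smul c (hm.memLp_mul f).toLp] with x h1 h2 h3 h4
          rw [h1, RingHom.id_apply, h4, Pi.smul_apply, h2, h3, Pi.smul_apply, mul_smul_comm] }
      (by
        obtain ⟨K, hK⟩ := hm.2
        exact ⟨K, norm_toLp_mul_le hm hK⟩)
  else 0

lemma mulOp_apply {m : α → ℝ} (hm : BddMeasurable m) (f : Lp ℂ 2 μ) :
    mulOp m f = (hm.memLp_mul f).toLp := by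
  simp only [mulOp, hm, dif_pos]
  rfl

lemma coeFn_mulOp {m : α → ℝ} (hm : BddMeasurable m) (f : Lp ℂ 2 μ) :
    mulOp m f =ᵐ[μ] fun x => (m x : ℂ) * f x := by
  rw [mulOp_apply hm]
  exact (hm.memLp_mul f).coeFn_toLp

lemma norm_mulOp_apply_le {m : α → ℝ} (hm : BddMeasurable m) {K : ℝ} (hK : ∀ x, |m x| ≤ K)
    (f : Lp ℂ 2 μ) : ‖mulOp m f‖ ≤ K * ‖f‖ := by
  rw [mulOp_apply hm]
  exact norm_toLp_mul_le hm hK f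

lemma norm_mulOp_le {m : α → ℝ} (hm : BddMeasurable m) {K : ℝ} (hK0 : 0 ≤ K)
    (hK : ∀ x, |m x| ≤ K) : ‖(mulOp m : Lp ℂ 2 μ →L[ℝ] Lp ℂ 2 μ)‖ ≤ K :=
  ContinuousLinearMap.opNorm_le_bound _ hK0 (norm_mulOp_apply_le hm hK)

lemma mulOp_mulOp {m k : α → ℝ} (hm : BddMeasurable m) (hk : BddMeasurable k) (f : Lp ℂ 2 μ) :
    mulOp m (mulOp k f) = mulOp (fun x => m x * k x) f := by
  apply Lp.ext
  filter_upwards [coeFn_mulOp hm (mulOp k f), coeFn_mulOp hk f,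
    coeFn_mulOp (hm.mul hk) f] with x h1 h2 h3
  rw [h1, h2, h3, Complex.ofReal_mul, mul_assoc]

lemma mulOp_add {m k : α → ℝ} (hm : BddMeasurable m) (hk : BddMeasurable k) (f : Lp ℂ 2 μ) :
    mulOp (fun x => m x + k x) f = mulOp m f + mulOp k f := by
  apply Lp.ext
  filter_upwards [coeFn_mulOp hm f, coeFn_mulOp hk f, coeFn_mulOp (hm.add hk) f,
    Lp.coeFn_add (mulOp m f) (mulOp k f)] with x h1 h2 h3 h4
  rw [h3, h4, Pi.add_apply, h1, h2, Complex.ofReal_add, add_mul]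

lemma mulOp_const_mul {m : α → ℝ} (c : ℝ) (hm : BddMeasurable m) (f : Lp ℂ 2 μ) :
    mulOp (fun x => c * m x) f = c • mulOp m f := by
  apply Lp.ext
  filter_upwards [coeFn_mulOp hm f, coeFn_mulOp (hm.const_mul c) f,
    Lp.coeFn_smul c (mulOp m f)] with x h1 h2 h3
  rw [h2, h3, Pi.smul_apply, h1, Complex.real_smul, Complex.ofReal_mul, mul_assoc]

lemma mulOp_one (f : Lp ℂ 2 μ) : mulOp (fun _ => 1) f = f := by
  apply Lp.ext
  filter_upwards [coeFn_mulOp (m := fun _ : α => (1 : ℝ))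
    ⟨measurable_const, 1, fun _ => by simp⟩ f] with x h1
  rw [h1, Complex.ofReal_one, one_mul]

lemma inner_mulOp {m : α → ℝ} (hm : BddMeasurable m) (f g : Lp ℂ 2 μ) :
    inner ℂ (mulOp m f) g = inner ℂ f (mulOp m g) := by
  rw [L2.inner_def, L2.inner_def]
  refine integral_congr_ae ?_
  filter_upwards [coeFn_mulOp hm f, coeFn_mulOp hm g] with x h1 h2
  rw [h1, h2]
  simp only [RCLike.inner_apply, map_mul, Complex.conj_ofReal]
  ring

lemma hasDerivAt_mulOp_exp {m : α → ℝ} (hm : BddMeasurable m) (s : ℝ) :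
    HasDerivAt (fun s : ℝ => (mulOp (fun x => Real.exp (s * m x)) : Lp ℂ 2 μ →L[ℝ] Lp ℂ 2 μ))
      (mulOp fun x => Real.exp (s * m x) * m x) s := by
  obtain ⟨K, hK⟩ := hm.2
  have hexp : ∀ s : ℝ, BddMeasurable (fun x => Real.exp (s * m x)) := fun s => (hm.const_mul s).exp
  rw [hasDerivAt_iff_isLittleO_nhds_zero]
  -- The derivative holds in operator norm: `|exp y - 1 - y| ≤ y²` for `|y| ≤ 1`, applied to `y = h
  -- m(x)`, is uniform in `x` because `m` is bounded.
  refine Asymptotics.IsBigO.trans_isLittleO (g := fun h : ℝ => h ^ 2) ?_ ?_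
  · refine Asymptotics.IsBigO.of_bound (Real.exp (|s| * K) * K ^ 2) ?_
    have hev : ∀ᶠ h : ℝ in nhds 0, |h| * K ≤ 1 := by
      have : Filter.Tendsto (fun h : ℝ => |h| * K) (nhds 0) (nhds 0) := by
        have : Continuous fun h : ℝ => |h| * K := by fun_prop
        simpa using this.tendsto 0
      exact (this.eventually (gt_mem_nhds one_pos)).mono fun _ h => h.le
    filter_upwards [hev] with h hh
    have hb : BddMeasurable (fun x => Real.exp ((s + h) * m x) +
        (-1 * Real.exp (s * m x) + (-h) * (Real.exp (s * m x) * m x))) :=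
      (hexp _).add (((hexp s).const_mul _).add (((hexp s).mul hm).const_mul _))
    have heq : (mulOp (fun x => Real.exp ((s + h) * m x)) : Lp ℂ 2 μ →L[ℝ] Lp ℂ 2 μ) -
        mulOp (fun x => Real.exp (s * m x)) - h • mulOp (fun x => Real.exp (s * m x) * m x) =
        mulOp (fun x => Real.exp ((s + h) * m x) +
          (-1 * Real.exp (s * m x) + (-h) * (Real.exp (s * m x) * m x))) := by
      ext1 f
      rw [mulOp_add (hexp _) (((hexp s).const_mul _).add (((hexp s).mul hm).const_mul _)),
        mulOp_add ((hexp s).const_mul _) (((hexp s).mul hm).const_mul _),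
        mulOp_const_mul _ (hexp s), mulOp_const_mul _ ((hexp s).mul hm)]
      simp only [sub_apply, smul_apply]
      module
    rw [heq]
    refine (norm_mulOp_le hb (by positivity) fun x => ?_)
    have h1 : Real.exp ((s + h) * m x) +
        (-1 * Real.exp (s * m x) + (-h) * (Real.exp (s * m x) * m x)) =
        Real.exp (s * m x) * (Real.exp (h * m x) - 1 - h * m x) := by
      rw [add_mul, Real.exp_add]; ring
    have hx : |h * m x| ≤ |h| * K := by
      rw [abs_mul]; exact mul_le_mul_of_nonneg_left (hK x) (abs_nonneg _)
    have h2 : |Real.exp (h * m x) - 1 - h * m x| ≤ K ^ 2 * h ^ 2 := by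
      refine (Real.abs_exp_sub_one_sub_id_le (hx.trans hh)).trans ?_
      rw [← sq_abs (h * m x)]
      calc |h * m x| ^ 2 ≤ (|h| * K) ^ 2 := pow_le_pow_left₀ (abs_nonneg _) hx 2
        _ = K ^ 2 * h ^ 2 := by rw [mul_pow, sq_abs]; ring
    have h3 : Real.exp (s * m x) ≤ Real.exp (|s| * K) := by
      refine Real.exp_le_exp.2 ((le_abs_self _).trans ?_)
      rw [abs_mul]; exact mul_le_mul_of_nonneg_left (hK x) (abs_nonneg _)
    rw [h1, abs_mul, abs_of_pos (Real.exp_pos _), norm_pow, Real.norm_eq_abs, sq_abs, mul_assoc]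
    exact mul_le_mul h3 h2 (abs_nonneg _) (Real.exp_pos _).le
  · simpa using Asymptotics.isLittleO_pow_id (𝕜 := ℝ) (n := 2) (by norm_num)

/-- The solution of `E' = -mE` in `L²` is `exp(-tm) E(0)`. -/
lemma eq_mulOp_exp_of_hasDerivWithinAt {m : α → ℝ} (hm : BddMeasurable m) {E : ℝ → Lp ℂ 2 μ}
    (hE : ∀ t, 0 ≤ t → HasDerivWithinAt E (-mulOp m (E t)) (Ici 0) t) {t : ℝ} (ht : 0 ≤ t) :
    E t = mulOp (fun x => Real.exp (-t * m x)) (E 0) := by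
  have hexp : ∀ s : ℝ, BddMeasurable (fun x => Real.exp (s * m x)) := fun s => (hm.const_mul s).exp
  have hF : ∀ s, 0 ≤ s → HasDerivWithinAt
      (fun s => mulOp (fun x => Real.exp (s * m x)) (E s)) 0 (Ici 0) s := by
    intro s hs
    have := (hasDerivAt_mulOp_exp (μ := μ) hm s).hasDerivWithinAt.clm_apply (hE s hs)
    rwa [map_neg, mulOp_mulOp (hexp s) hm, add_neg_cancel] at this
  have hc := constant_of_has_deriv_right_zero (a := 0) (b := t)
    (fun s hs => ((hF s hs.1).continuousWithinAt).mono Icc_subset_Ici_self)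
    (fun s hs => (hF s hs.1).mono (Ici_subset_Ici.2 hs.1)) t ⟨ht, le_rfl⟩
  simp only [zero_mul, Real.exp_zero, mulOp_one] at hc
  rw [← hc, mulOp_mulOp (hexp _) (hexp _)]
  simp only [← Real.exp_add, neg_mul, neg_add_cancel, Real.exp_zero, mulOp_one]

end Multiplier

/-! ### Exponential decay by a modified energy -/

section Energy

variable {H : Type*} [NormedAddCommGroup H] [InnerProductSpace ℂ H]

/-- Exponential decay for the damped system `X' = -BY - X`, `Y' = BX` with `B` symmetric
and boundedly invertible along the solution, where `Y = BW` and `W' = X`. -/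
lemma damped_system_decay {X Y W : ℝ → H} {B : H → H}
    (hB : ∀ x y, inner ℂ (B x) y = inner ℂ x (B y)) (hWY : ∀ t, ‖W t‖ ≤ 3 * ‖Y t‖)
    (hBW : ∀ t, B (W t) = Y t)
    (hW : ∀ t, 0 ≤ t → HasDerivWithinAt W (X t) (Ici 0) t)
    (hX : ∀ t, 0 ≤ t → HasDerivWithinAt X (-B (Y t) - X t) (Ici 0) t)
    (hY : ∀ t, 0 ≤ t → HasDerivWithinAt Y (B (X t)) (Ici 0) t) {t : ℝ} (ht : 0 ≤ t) :
    ‖X t‖ ^ 2 + ‖Y t‖ ^ 2 ≤ 2 * Real.exp (-t / 15) * (‖X 0‖ ^ 2 + ‖Y 0‖ ^ 2) := by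
  set c : ℝ → ℝ := fun s => (inner ℂ (X s) (W s)).re with hc
  -- The plain energy only dissipates `-2‖X‖²`. The cross term contributes `-‖Y‖²` to the
  -- derivative, through `⟨BY, W⟩ = ⟨Y, BW⟩ = ‖Y‖²`. With `|c| ≤ 3‖X‖‖Y‖`, the weight 1/6 keeps `e`
  -- within factors 3/4 and 5/4 of the energy.
  set e : ℝ → ℝ := fun s => ‖X s‖ ^ 2 + ‖Y s‖ ^ 2 + 1 / 6 * c s with he
  have hcb : ∀ s, |c s| ≤ 3 * ‖X s‖ * ‖Y s‖ := fun s => by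
    refine (Complex.abs_re_le_norm _).trans ((norm_inner_le_norm _ _).trans ?_)
    nlinarith [mul_le_mul_of_nonneg_left (hWY s) (norm_nonneg (X s))]
  have hsq : ∀ x : H, ‖x‖ ^ 2 = (inner ℂ x x).re := fun x => by
    rw [inner_self_eq_norm_sq_to_K]; norm_cast
  have hre : ∀ {f : ℝ → ℂ} {f' : ℂ} {s : ℝ}, HasDerivWithinAt f f' (Ici 0) s →
      HasDerivWithinAt (fun s => (f s).re) f'.re (Ici 0) s := fun {f f' s} hf => by
    exact Complex.reCLM.hasFDerivAt.comp_hasDerivWithinAt s hf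
  have hsymm : ∀ x y : H, (inner ℂ x y).re = (inner ℂ y x).re := fun x y => by
    rw [← inner_conj_symm, Complex.conj_re]
  have hed : ∀ s, 0 ≤ s → HasDerivWithinAt e
      (-2 * ‖X s‖ ^ 2 + 1 / 6 * (‖X s‖ ^ 2 - ‖Y s‖ ^ 2 - c s)) (Ici 0) s := by
    intro s hs
    have h1 := hre ((hX s hs).inner ℂ (hX s hs))
    have h2 := hre ((hY s hs).inner ℂ (hY s hs))
    have h3 := hre ((hX s hs).inner ℂ (hW s hs))
    have h4 := (h1.add h2).add (h3.const_mul (1 / 6))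
    simp only [he, hc, hsq]
    refine h4.congr_deriv ?_
    simp only [inner_sub_left, inner_sub_right, inner_neg_left, inner_neg_right,
      Complex.add_re, Complex.sub_re, Complex.neg_re]
    rw [hB (Y s) (W s), hBW s, hsymm (B (Y s)) (X s), ← hB (X s) (Y s),
      hsymm (B (X s)) (Y s)]
    ring
  have hlo : ∀ s, 3 / 4 * (‖X s‖ ^ 2 + ‖Y s‖ ^ 2) ≤ e s := fun s => by
    have := neg_le_of_abs_le (hcb s)
    simp only [he]; nlinarith [sq_nonneg (‖X s‖ - ‖Y s‖)]
  have hup : ∀ s, e s ≤ 5 / 4 * (‖X s‖ ^ 2 + ‖Y s‖ ^ 2) := fun s => by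
    have := le_of_abs_le (hcb s)
    simp only [he]; nlinarith [sq_nonneg (‖X s‖ - ‖Y s‖)]
  have hexp : ∀ s : ℝ, HasDerivAt (fun s : ℝ => Real.exp (s / 15)) (Real.exp (s / 15) * (1 / 15)) s :=
    fun s => ((hasDerivAt_id s).div_const 15).exp
  have hgd : ∀ s, 0 ≤ s → HasDerivWithinAt (fun s => Real.exp (s / 15) * e s)
      (Real.exp (s / 15) * (1 / 15) * e s + Real.exp (s / 15) *
        (-2 * ‖X s‖ ^ 2 + 1 / 6 * (‖X s‖ ^ 2 - ‖Y s‖ ^ 2 - c s))) (Ici 0) s :=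
    fun s hs => (hexp s).hasDerivWithinAt.mul (hed s hs)
  have hanti : AntitoneOn (fun s => Real.exp (s / 15) * e s) (Ici 0) := by
    refine antitoneOn_of_hasDerivWithinAt_nonpos (convex_Ici 0)
      (fun s hs => (hgd s hs).continuousWithinAt)
      (fun s hs => (hgd s (interior_subset hs)).mono interior_subset) (fun s hs => ?_)
    have h1 := hup s
    have h2 := neg_le_of_abs_le (hcb s)
    -- By `hup` and `hcb`, the left side is at most `-‖X‖² - (3‖X‖ - ‖Y‖)²/12`.
    have h3 : 1 / 15 * e s + (-2 * ‖X s‖ ^ 2 + 1 / 6 * (‖X s‖ ^ 2 - ‖Y s‖ ^ 2 - c s)) ≤ 0 := by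
      nlinarith [sq_nonneg (3 * ‖X s‖ - ‖Y s‖)]
    nlinarith [mul_nonpos_of_nonneg_of_nonpos (Real.exp_pos (s / 15)).le h3]
  have h0 := hanti (mem_Ici.2 le_rfl) (mem_Ici.2 ht) ht
  simp only [zero_div, Real.exp_zero, one_mul] at h0
  have h1 : e t ≤ Real.exp (-t / 15) * e 0 := by
    have : e t = Real.exp (-t / 15) * (Real.exp (t / 15) * e t) := by
      rw [← mul_assoc, ← Real.exp_add, neg_div, neg_add_cancel, Real.exp_zero, one_mul]
    rw [this]
    exact mul_le_mul_of_nonneg_left h0 (Real.exp_pos _).le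
  have h2 := mul_le_mul_of_nonneg_left (hup 0) (Real.exp_pos (-t / 15)).le
  have h3 : 0 ≤ Real.exp (-t / 15) * (‖X 0‖ ^ 2 + ‖Y 0‖ ^ 2) := by positivity
  nlinarith [hlo t]

end Energy

/-! ### The Fourier transform on `L²`, on `L¹`, and of the Gauss kernel -/

section Fourier

open FourierTransform

variable {n : ℕ}

lemma integral_mul_eq_toTemperedDistribution (f : L2 n) (ψ : 𝓢(Space n, ℂ)) :
    ∫ x, f x * ψ x = Lp.toTemperedDistribution f ψ := by
  rw [Lp.toTemperedDistribution_apply]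
  simp only [smul_eq_mul, mul_comm]

lemma integral_fourier_mul (f : L2 n) (ψ : 𝓢(Space n, ℂ)) :
    ∫ x, (𝓕 f : L2 n) x * ψ x = ∫ x, f x * (𝓕 ψ : 𝓢(Space n, ℂ)) x := by
  rw [integral_mul_eq_toTemperedDistribution, integral_mul_eq_toTemperedDistribution,
    ← Lp.fourier_toTemperedDistribution_eq, TemperedDistribution.fourier_apply]

/-- This is the injectivity of the embedding of `L²` into tempered distributions. -/
lemma eq_zero_of_integral_mul_schwartz_eq_zero {f : L2 n}
    (h : ∀ ψ : 𝓢(Space n, ℂ), ∫ x, f x * ψ x = 0) : f = 0 := by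
  have := Lp.ker_toTemperedDistributionCLM_eq_bot (F := ℂ) (p := 2)
    (μ := (volume : Measure (Space n)))
  rw [LinearMap.ker_eq_bot'] at this
  refine this f ?_
  ext ψ
  have h1 := h ψ
  rw [integral_mul_eq_toTemperedDistribution] at h1
  exact h1

lemma integrable_mul_schwartz (f : L2 n) (ψ : 𝓢(Space n, ℂ)) :
    Integrable (fun x => f x * ψ x) :=
  (Lp.memLp f).integrable_mul (ψ.memLp 2 volume)

/-- On `L¹ ∩ L²` the two Fourier transforms agree. -/
lemma coeFn_fourier_of_integrable {f : L2 n} (hf : Integrable f) :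
    (𝓕 f : L2 n) =ᵐ[volume] 𝓕 (f : Space n → ℂ) := by
  have hcont : Continuous (𝓕 (f : Space n → ℂ)) :=
    VectorFourier.fourierIntegral_continuous Real.continuous_fourierChar
      (by exact continuous_inner) hf
  have hloc : LocallyIntegrable (fun x => (𝓕 f : L2 n) x - 𝓕 (f : Space n → ℂ) x) :=
    ((Lp.memLp (𝓕 f : L2 n)).locallyIntegrable (by norm_num)).sub hcont.locallyIntegrable
  -- Both transforms move onto a test function in the same way: the `L²` one by duality, the
  -- integral one by Fubini.
  have key := ae_eq_zero_of_integral_contDiff_smul_eq_zero hloc fun g hg hgc => by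
    set ψ : 𝓢(Space n, ℂ) := HasCompactSupport.toSchwartzMap (f := fun x => (g x : ℂ))
      (hgc.comp_left (g := Complex.ofReal) rfl) (Complex.ofRealCLM.contDiff.comp hg)
    have hψ : ∀ x, ψ x = g x := fun x => rfl
    have h1 := integral_fourier_mul f ψ
    have h2 : ∫ x, 𝓕 (f : Space n → ℂ) x * ψ x = ∫ x, f x * (𝓕 (ψ : Space n → ℂ)) x := by
      have := VectorFourier.integral_fourierIntegral_smul_eq_flip (f := (f : Space n → ℂ))
        (g := (ψ : Space n → ℂ)) (L := innerₗ (Space n)) (μ := volume) (ν := volume)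
        Real.continuous_fourierChar (by exact continuous_inner) hf ψ.integrable
      simp only [smul_eq_mul, flip_innerₗ] at this
      exact this
    rw [SchwartzMap.fourier_coe, ← h2] at h1
    have h3 : Integrable fun x => 𝓕 (f : Space n → ℂ) x * ψ x := by
      refine Continuous.integrable_of_hasCompactSupport (hcont.mul ψ.continuous) ?_
      exact HasCompactSupport.mul_left (hgc.comp_left (g := Complex.ofReal) rfl)
    calc ∫ x, g x • ((𝓕 f : L2 n) x - 𝓕 (f : Space n → ℂ) x)
        = ∫ x, ((𝓕 f : L2 n) x * ψ x - 𝓕 (f : Space n → ℂ) x * ψ x) := by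
          refine integral_congr_ae (Filter.Eventually.of_forall fun x => ?_)
          simp only [hψ, Complex.real_smul]; ring
      _ = 0 := by rw [integral_sub (integrable_mul_schwartz _ _) h3, h1, sub_self]
  filter_upwards [key] with x hx
  exact sub_eq_zero.1 hx

lemma norm_fourier_le_integral {f : Space n → ℂ} (ξ : Space n) : ‖𝓕 f ξ‖ ≤ ∫ x, ‖f x‖ := 
  VectorFourier.norm_fourierIntegral_le_integral_norm _ _ _ _ _

/-- The integral is the transform at frequency 0, and `|exp(iθ) - 1| ≤ |θ|` costs one moment of `f`.
The weight `1 + |x|` is needed here. -/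
lemma norm_fourier_sub_integral_le {f : Space n → ℂ} (hf : MemWeightedL1 1 f) (ξ : Space n) :
    ‖𝓕 f ξ - ∫ x, f x‖ ≤ 2 * Real.pi * ‖ξ‖ * weightedL1Norm 1 f := by
  have hint : Integrable fun x => Real.fourierChar (-inner ℝ x ξ) • f x := by
    simpa using (Real.fourierIntegral_convergent_iff (μ := volume) (f := f) ξ).2 hf.1
  rw [Real.fourier_eq, ← integral_sub hint hf.1, weightedL1Norm, ← integral_const_mul]
  refine norm_integral_le_of_norm_le (hf.2.const_mul _) (Filter.Eventually.of_forall fun x => ?_)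
  have h1 : ‖(Real.fourierChar (-inner ℝ x ξ) : ℂ) - 1‖ ≤ 2 * Real.pi * ‖ξ‖ * (1 + ‖x‖) := by
    rw [Real.fourierChar_apply]
    have := Real.norm_exp_I_mul_ofReal_sub_one_le (x := 2 * Real.pi * (-inner ℝ x ξ))
    rw [mul_comm Complex.I] at this
    refine this.trans ?_
    rw [norm_mul, norm_neg, Real.norm_of_nonneg (by positivity)]
    have h2 := norm_inner_le_norm (𝕜 := ℝ) x ξ
    have h3 := Real.pi_pos
    have h4 := norm_nonneg ξ
    calc 2 * Real.pi * ‖inner ℝ x ξ‖ ≤ 2 * Real.pi * (‖x‖ * ‖ξ‖) := by gcongr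
      _ ≤ 2 * Real.pi * ‖ξ‖ * (1 + ‖x‖) := by nlinarith [mul_nonneg h3.le h4]
  have h5 : Real.fourierChar (-inner ℝ x ξ) • f x - f x
      = ((Real.fourierChar (-inner ℝ x ξ) : ℂ) - 1) * f x := by
    rw [Circle.smul_def, smul_eq_mul]; ring
  rw [h5, norm_mul, pow_one, ← mul_assoc]
  exact mul_le_mul_of_nonneg_right h1 (norm_nonneg _)

lemma integral_norm_le_weightedL1Norm {f : Space n → ℂ} (hf : MemWeightedL1 1 f) :
    ∫ x, ‖f x‖ ≤ weightedL1Norm 1 f := by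
  refine integral_mono hf.1.norm hf.2 fun x => ?_
  rw [pow_one]
  nlinarith [norm_nonneg x, norm_nonneg (f x), mul_nonneg (norm_nonneg x) (norm_nonneg (f x))]

lemma gaussKernel_eq (t : ℝ) (x : Space n) :
    (gaussKernel t x : ℂ) =
      (1 / (Real.sqrt (4 * Real.pi * t)) ^ n : ℝ) * Complex.exp (-(1 / (4 * t) : ℂ) * ‖x‖ ^ 2) := by
  rw [gaussKernel, Complex.ofReal_mul, Complex.ofReal_exp]
  congr 2
  push_cast
  ring

lemma integrable_gaussKernel {t : ℝ} (ht : 0 < t) :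
    Integrable (fun x : Space n => (gaussKernel t x : ℂ)) := by
  simp only [gaussKernel_eq t]
  have hb : 0 < (1 / (4 * t) : ℂ).re := by
    have : (1 / (4 * t) : ℂ) = ((1 / (4 * t) : ℝ) : ℂ) := by push_cast; rfl
    rw [this, Complex.ofReal_re]; positivity
  refine Integrable.const_mul ?_ _
  simpa using GaussianFourier.integrable_cexp_neg_mul_sq_norm_add hb 0 (0 : Space n)

lemma fourier_gaussKernel {t : ℝ} (ht : 0 < t) (ξ : Space n) :
    𝓕 (fun x : Space n => (gaussKernel t x : ℂ)) ξ =
      (Real.exp (-(4 * Real.pi ^ 2 * ‖ξ‖ ^ 2) * t) : ℂ) := by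
  have hb : 0 < (1 / (4 * t) : ℂ).re := by
    have : (1 / (4 * t) : ℂ) = ((1 / (4 * t) : ℝ) : ℂ) := by push_cast; rfl
    rw [this, Complex.ofReal_re]; positivity
  have hG := fourier_gaussian_innerProductSpace hb ξ
  have h1 : (fun x : Space n => (gaussKernel t x : ℂ)) =
      ((1 / (Real.sqrt (4 * Real.pi * t)) ^ n : ℝ) : ℂ) •
        fun x : Space n => Complex.exp (-(1 / (4 * t) : ℂ) * ‖x‖ ^ 2) := by
    funext x; simp only [gaussKernel_eq t, Pi.smul_apply, smul_eq_mul]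
  have htC : (t : ℂ) ≠ 0 := by exact_mod_cast ht.ne'
  have h2 : ((Real.pi : ℂ) / (1 / (4 * t) : ℂ)) ^ (Module.finrank ℝ (Space n) / 2 : ℂ) =
      ((Real.sqrt (4 * Real.pi * t) ^ n : ℝ) : ℂ) := by
    have h4 : (0 : ℝ) ≤ 4 * Real.pi * t := by positivity
    rw [finrank_euclideanSpace_fin, show ((Real.pi : ℂ) / (1 / (4 * t) : ℂ)) =
      ((4 * Real.pi * t : ℝ) : ℂ) by push_cast; field_simp,
      show ((n : ℂ) / 2) = ((n / 2 : ℝ) : ℂ) by push_cast; rfl, ← Complex.ofReal_cpow h4,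
      Real.sqrt_eq_rpow, ← Real.rpow_natCast, ← Real.rpow_mul h4]
    congr 2; ring
  have h3 : Real.sqrt (4 * Real.pi * t) ^ n ≠ 0 := by positivity
  have hsmul : ∀ (c : ℂ) (f : Space n → ℂ), 𝓕 (c • f) = c • 𝓕 f := fun c f =>
    VectorFourier.fourierIntegral_const_smul _ _ _ f c
  rw [h1, hsmul, Pi.smul_apply, hG, h2, smul_eq_mul, ← mul_assoc, ← Complex.ofReal_mul,
    one_div_mul_cancel h3, Complex.ofReal_one, one_mul, Complex.ofReal_exp]
  congr 1
  push_cast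
  field_simp

end Fourier

/-! ### From the weak equation to an ODE in frequency -/

open FourierTransform LineDeriv Laplacian

variable {n : ℕ}

/-- The symbol `4π²|ξ|²` of `-Δ`. -/
def symbol (ξ : Space n) : ℝ := 4 * Real.pi ^ 2 * ‖ξ‖ ^ 2

lemma symbol_nonneg (ξ : Space n) : 0 ≤ symbol ξ := by unfold symbol; positivity

lemma measurable_symbol : Measurable (symbol : Space n → ℝ) := by
  unfold symbol; fun_prop

/-- Each derivative of `𝓕 ψ` multiplies `ψ` by `-2πi ξⱼ`; two of them, summed over `j`, give
`-4π²|ξ|²`. -/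
lemma laplacian_fourier (ψ : 𝓢(Space n, ℂ)) :
    Δ (𝓕 ψ) = 𝓕 (SchwartzMap.smulLeftCLM ℂ (fun ξ : Space n => -symbol ξ) ψ) := by
  rw [SchwartzMap.laplacian_eq_sum (EuclideanSpace.basisFun (Fin n) ℝ)]
  have hsum : SchwartzMap.smulLeftCLM ℂ (fun ξ : Space n => -symbol ξ) ψ =
      ∑ j, (-(2 * Real.pi * Complex.I)) • SchwartzMap.smulLeftCLM ℂ
        (inner ℝ · (EuclideanSpace.basisFun (Fin n) ℝ j))
        ((-(2 * Real.pi * Complex.I)) • SchwartzMap.smulLeftCLM ℂ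
          (inner ℝ · (EuclideanSpace.basisFun (Fin n) ℝ j)) ψ) := by
    ext ξ
    rw [SchwartzMap.smulLeftCLM_apply_apply (by unfold symbol; fun_prop), sum_apply]
    have hterm : ∀ j, ((-(2 * Real.pi * Complex.I)) • SchwartzMap.smulLeftCLM ℂ
        (inner ℝ · (EuclideanSpace.basisFun (Fin n) ℝ j))
        ((-(2 * Real.pi * Complex.I)) • SchwartzMap.smulLeftCLM ℂ
          (inner ℝ · (EuclideanSpace.basisFun (Fin n) ℝ j)) ψ)) ξ =
        -(4 * Real.pi ^ 2 * ψ ξ) * ((inner ℝ ξ (EuclideanSpace.basisFun (Fin n) ℝ j) ^ 2 : ℝ) : ℂ) := by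
      intro j
      rw [smul_apply, SchwartzMap.smulLeftCLM_apply_apply (by fun_prop),
        smul_apply, SchwartzMap.smulLeftCLM_apply_apply (by fun_prop)]
      simp only [smul_eq_mul, Complex.real_smul]
      push_cast
      ring_nf
      rw [Complex.I_sq]
      ring
    simp only [hterm]
    rw [← Finset.mul_sum, ← Complex.ofReal_sum, (EuclideanSpace.basisFun (Fin n) ℝ).sum_sq_inner_left,
      symbol, Complex.real_smul]
    push_cast
    ring
  rw [hsum]
  refine Eq.trans ?_ (map_sum (fourierCLM ℂ 𝓢(Space n, ℂ)) _ Finset.univ).symm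
  refine Finset.sum_congr rfl fun j _ => ?_
  rw [SchwartzMap.lineDerivOp_fourier_eq, SchwartzMap.lineDerivOp_fourier_eq]
  rfl

lemma integral_grad_mul {f : L2 n} {g : L2Vec n} (h : IsWeakGradient f g) (φ : 𝓢(Space n, ℂ)) :
    ∫ x, ∑ j : Fin n, g x j * partialDeriv j φ x = -∫ x, f x * (Δ φ) x := by
  have hpd : ∀ (j : Fin n) (φ : 𝓢(Space n, ℂ)) x,
      partialDeriv j φ x = (∂_{EuclideanSpace.single j (1 : ℝ)} φ : 𝓢(Space n, ℂ)) x := fun j φ x => by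
    rw [SchwartzMap.lineDerivOp_apply_eq_fderiv, partialDeriv]
  have hg : ∀ j : Fin n, MemLp (fun x => g x j) 2 volume := fun j =>
    (EuclideanSpace.proj (𝕜 := ℂ) j).comp_memLp' (Lp.memLp g)
  rw [SchwartzMap.laplacian_eq_sum (EuclideanSpace.basisFun (Fin n) ℝ), integral_finsetSum]
  · simp only [sum_apply, Finset.mul_sum]
    rw [integral_finsetSum _ fun j _ => integrable_mul_schwartz _ _, ← Finset.sum_neg_distrib]
    refine Finset.sum_congr rfl fun j _ => ?_
    have := h j (∂_{EuclideanSpace.single j (1 : ℝ)} φ : 𝓢(Space n, ℂ))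
    simp only [hpd] at this ⊢
    rw [EuclideanSpace.basisFun_apply, this, neg_neg]
  · intro j _
    simp only [hpd]
    exact (hg j).integrable_mul (SchwartzMap.memLp _ 2 volume)

/-- The pairing `f ↦ ∫ f η` with a Schwartz function, as a functional on `L²`. -/
def pairing (η : 𝓢(Space n, ℂ)) : L2 n →L[ℝ] ℂ :=
  (((ContinuousLinearMap.mul ℂ ℂ).lpPairing volume 2 2).flip (η.toLp 2)).restrictScalars ℝ

lemma pairing_apply (η : 𝓢(Space n, ℂ)) (f : L2 n) : pairing η f = ∫ x, f x * η x := by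
  simp only [pairing, ContinuousLinearMap.coe_restrictScalars', ContinuousLinearMap.flip_apply,
    ContinuousLinearMap.lpPairing_eq_integral]
  refine integral_congr_ae ?_
  filter_upwards [η.coeFn_toLp 2 volume] with x hx
  rw [hx, ContinuousLinearMap.mul_apply']

/-- A continuous curve in `L²` with a continuous weak derivative on `(0, ∞)` is differentiable
up to `0`. -/
lemma hasDerivWithinAt_of_pairing {W Y : ℝ → L2 n} (hW : ContinuousOn W (Ici 0))
    (hY : ContinuousOn Y (Ici 0))
    (h : ∀ η : 𝓢(Space n, ℂ), ∀ t, 0 < t →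
      HasDerivAt (fun s => pairing η (W s)) (pairing η (Y t)) t) {t : ℝ} (ht : 0 ≤ t) :
    HasDerivWithinAt W (Y t) (Ici 0) t := by
  -- Freezing `Y` at negative times makes it continuous on the whole line, so its primitive `Z` is
  -- differentiable everywhere, including at 0. It remains to show `W = Z` on `[0, ∞)`, which is
  -- tested by pairings.
  set Y' : ℝ → L2 n := fun s => Y (max s 0) with hY'
  have hYc : Continuous Y' :=
    hY.comp_continuous (continuous_id.max continuous_const) fun s => le_max_right s 0
  have hYeq : ∀ s, 0 ≤ s → Y' s = Y s := fun s hs => by simp only [hY', max_eq_left hs]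
  set Z : ℝ → L2 n := fun s => W 0 + ∫ r in (0 : ℝ)..s, Y' r with hZ
  have hZd : ∀ s, HasDerivAt Z (Y' s) s := fun s =>
    (hYc.integral_hasStrictDerivAt 0 s).hasDerivAt.const_add (W 0)
  have hWZ : ∀ s, 0 ≤ s → W s = Z s := by
    intro s hs
    rw [← sub_eq_zero]
    refine eq_zero_of_integral_mul_schwartz_eq_zero fun η => ?_
    rw [← pairing_apply]
    set g : ℝ → ℂ := fun r => pairing η (W r - Z r) with hg
    have hgd : ∀ r, 0 < r → HasDerivAt g 0 r := fun r hr => by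
      have h1 := (h η r hr).sub ((pairing η).hasFDerivAt.comp_hasDerivAt r (hZd r))
      rw [hYeq r hr.le, sub_self] at h1
      simp only [hg, map_sub]
      exact h1
    have hgc : ContinuousOn g (Ici 0) := (pairing η).continuous.comp_continuousOn
      (hW.sub fun r _ => (hZd r).continuousAt.continuousWithinAt)
    -- The hypothesis covers positive times only; the one-sided derivative at 0 is the limit of the
    -- derivatives.
    have hgd0 : HasDerivWithinAt g 0 (Ici 0) 0 := by
      refine hasDerivWithinAt_Ici_of_tendsto_deriv (s := Ioi 0)
        (fun r hr => (hgd r hr).differentiableAt.differentiableWithinAt)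
        ((hgc 0 self_mem_Ici).mono Ioi_subset_Ici_self) self_mem_nhdsWithin ?_
      refine tendsto_const_nhds.congr' ?_
      filter_upwards [self_mem_nhdsWithin] with r hr
      rw [(hgd r hr).deriv]
    have := constant_of_has_deriv_right_zero (hgc.mono fun r hr => hr.1)
      (fun r hr => by
        rcases hr.1.eq_or_lt with rfl | h0
        · exact hgd0
        · exact (hgd r h0).hasDerivWithinAt) s ⟨hs, le_rfl⟩
    simpa [hg, hZ] using this
  rw [← hYeq t ht]
  exact (hZd t).hasDerivWithinAt.congr (fun s hs => hWZ s hs) (hWZ t ht)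

/-- The Fourier transform of a weak solution solves `U'' + U' + 4π²|ξ|²U = 0` after
multiplication by sufficiently decaying multipliers. -/
lemma IsWeakSolution.exists_fourier {u₀ : H1 n} {u₁ : L2 n} {u : ℝ → H1 n}
    (h : IsWeakSolution u₀ u₁ u) :
    ∃ V : ℝ → L2 n, (V 0 = 𝓕 u₁) ∧
      (∀ t, 0 ≤ t → HasDerivWithinAt (fun s => (𝓕 (u s).toL2 : L2 n)) (V t) (Ici 0) t) ∧
      ∀ g : Space n → ℝ, BddMeasurable g → BddMeasurable (fun ξ => g ξ * (1 + ‖ξ‖ ^ 2)) →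
        ∀ t, 0 ≤ t → HasDerivWithinAt (fun s => mulOp g (V s))
          (-mulOp (fun ξ => g ξ * symbol ξ) (𝓕 (u t).toL2 : L2 n) - mulOp g (V t)) (Ici 0) t := by
  obtain ⟨-, -, v, hvc, huv, hv0, hwk⟩ := h
  set F : L2 n →L[ℝ] L2 n :=
    ((Lp.fourierTransformₗᵢ (Space n) ℂ).toContinuousLinearEquiv : L2 n →L[ℂ] L2 n).restrictScalars ℝ
  have hUd : ∀ t, 0 ≤ t → HasDerivWithinAt (fun s => (𝓕 (u s).toL2 : L2 n)) (𝓕 (v t)) (Ici 0) t :=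
    fun t ht => F.hasFDerivAt.comp_hasDerivWithinAt t (huv t ht)
  have hUc : ContinuousOn (fun s => (𝓕 (u s).toL2 : L2 n)) (Ici 0) :=
    fun t ht => (hUd t ht).continuousWithinAt
  have hVc : ContinuousOn (fun s => (𝓕 (v s) : L2 n)) (Ici 0) := F.continuous.comp_continuousOn hvc
  refine ⟨fun s => 𝓕 (v s), congrArg _ hv0, hUd, fun g hg hg2 t ht => ?_⟩
  -- This weight compensates the quadratic growth of the symbol, so the equation for `wV` has a
  -- continuous `L²` right-hand side. It also has temperate growth, hence maps Schwartz functions to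
  -- Schwartz functions. A general `g` is then reached by applying the bounded multiplier `g(1 +
  -- |ξ|²)`.
  set w : Space n → ℝ := fun ξ => (1 + ‖ξ‖ ^ 2) ^ (-1 : ℝ) with hw
  have hwinv : ∀ ξ, w ξ = (1 + ‖ξ‖ ^ 2)⁻¹ := fun ξ => Real.rpow_neg_one _
  have hwt : Function.HasTemperateGrowth w := Function.hasTemperateGrowth_one_add_norm_sq_rpow _ _
  have hst : Function.HasTemperateGrowth (fun ξ : Space n => -symbol ξ) := by
    unfold symbol; fun_prop
  have hwb : BddMeasurable w := by
    refine ⟨by fun_prop, 1, fun ξ => ?_⟩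
    rw [hwinv, abs_of_nonneg (by positivity)]
    exact inv_le_one_of_one_le₀ (by nlinarith [norm_nonneg ξ])
  have hwsb : BddMeasurable (fun ξ => w ξ * symbol ξ) := by
    refine ⟨hwb.1.mul measurable_symbol, 4 * Real.pi ^ 2, fun ξ => ?_⟩
    beta_reduce
    rw [hwinv, abs_of_nonneg (mul_nonneg (by positivity) (symbol_nonneg ξ)), inv_mul_le_iff₀
      (by positivity), symbol]
    nlinarith [sq_nonneg Real.pi]
  have key := hasDerivWithinAt_of_pairing (W := fun s => mulOp w (𝓕 (v s) : L2 n))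
    (Y := fun s => -mulOp (fun ξ => w ξ * symbol ξ) (𝓕 (u s).toL2 : L2 n) - mulOp w (𝓕 (v s) : L2 n))
    ((mulOp w).continuous.comp_continuousOn hVc)
    (((mulOp _).continuous.comp_continuousOn hUc).neg.sub ((mulOp w).continuous.comp_continuousOn hVc))
    (fun η t ht => by
      set ψ := SchwartzMap.smulLeftCLM ℂ w η with hψ
      have hψa : ∀ ξ, ψ ξ = w ξ * η ξ := fun ξ => by
        rw [hψ, SchwartzMap.smulLeftCLM_apply_apply hwt, Complex.real_smul]
      have hpw : ∀ f : L2 n, pairing η (mulOp w f) = ∫ ξ, f ξ * ψ ξ := fun f => by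
        rw [pairing_apply]
        refine integral_congr_ae ?_
        filter_upwards [coeFn_mulOp hwb f] with ξ h1
        rw [h1, hψa]; ring
      have hps : ∀ f : L2 n, pairing η (mulOp (fun ξ => w ξ * symbol ξ) f) =
          -∫ ξ, f ξ * SchwartzMap.smulLeftCLM ℂ (fun ξ : Space n => -symbol ξ) ψ ξ := fun f => by
        rw [pairing_apply, ← integral_neg]
        refine integral_congr_ae ?_
        filter_upwards [coeFn_mulOp hwsb f] with ξ h1
        rw [h1, SchwartzMap.smulLeftCLM_apply_apply hst, hψa, Complex.real_smul]
        push_cast; ring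
      -- Testing with `𝓕 ψ` moves the transform back onto the solution and turns the Laplacian into
      -- the symbol acting on `ψ`.
      have h1 := hwk (𝓕 ψ) t ht
      rw [integral_grad_mul (f := (u t).toL2) (g := (u t).grad) (u t).2, neg_neg, laplacian_fourier] at h1
      simp only [← integral_fourier_mul] at h1
      simp only [map_sub, map_neg, hpw, hps, neg_neg]
      exact h1) ht
  have h2 := (mulOp (fun ξ => g ξ * (1 + ‖ξ‖ ^ 2))).hasFDerivAt.comp_hasDerivWithinAt t key
  have hgw : ∀ ξ, g ξ * (1 + ‖ξ‖ ^ 2) * w ξ = g ξ := fun ξ => by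
    rw [hwinv]; field_simp
  have hgws : ∀ ξ, g ξ * (1 + ‖ξ‖ ^ 2) * (w ξ * symbol ξ) = g ξ * symbol ξ := fun ξ => by
    rw [← mul_assoc, hgw]
  simp only [Function.comp_def, map_sub, map_neg, mulOp_mulOp hg2 hwb, mulOp_mulOp hg2 hwsb, hgw,
    hgws] at h2
  exact h2

/-! ### The frequency system: explicit modes at low frequency, decay at high frequency -/

/-- The damped oscillator system `U' = V`, `V' = -4π²|ξ|²U - V` in `L²`, the second equation being
understood after multiplication by sufficiently decaying multipliers. -/
def IsFrequencySolution (U V : ℝ → L2 n) : Prop :=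
  (∀ t, 0 ≤ t → HasDerivWithinAt U (V t) (Ici 0) t) ∧
  ∀ g : Space n → ℝ, BddMeasurable g → BddMeasurable (fun ξ => g ξ * (1 + ‖ξ‖ ^ 2)) →
    ∀ t, 0 ≤ t → HasDerivWithinAt (fun s => mulOp g (V s))
      (-mulOp (fun ξ => g ξ * symbol ξ) (U t) - mulOp g (V t)) (Ici 0) t

lemma norm_sq_le_symbol (ξ : Space n) : ‖ξ‖ ^ 2 ≤ symbol ξ := by
  have h := Real.pi_gt_three
  unfold symbol
  nlinarith [sq_nonneg ‖ξ‖, mul_nonneg (sq_nonneg ‖ξ‖) (by nlinarith : 0 ≤ 4 * Real.pi ^ 2 - 1)]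

/-- A bounded function of compact support in the symbol stays bounded after multiplication by
`1 + |ξ|²`. -/
lemma BddMeasurable.mul_one_add_norm_sq {g : Space n → ℝ} (hg : BddMeasurable g) {R : ℝ}
    (hR : ∀ ξ, R < symbol ξ → g ξ = 0) : BddMeasurable (fun ξ => g ξ * (1 + ‖ξ‖ ^ 2)) := by
  obtain ⟨hm, K, hK⟩ := hg
  refine ⟨hm.mul (by fun_prop), K * (1 + |R|), fun ξ => ?_⟩
  have hK0 : 0 ≤ K := (abs_nonneg _).trans (hK ξ)
  rw [abs_mul, abs_of_nonneg (by positivity : 0 ≤ 1 + ‖ξ‖ ^ 2)]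
  by_cases h : R < symbol ξ
  · rw [hR ξ h, abs_zero, zero_mul]; positivity
  · refine mul_le_mul (hK ξ) ?_ (by positivity) hK0
    have := (norm_sq_le_symbol ξ).trans ((not_lt.1 h).trans (le_abs_self R))
    linarith

/-- Where `ρ(1 - ρ) = 4π²|ξ|²`, the equation factorizes and `V + ρU` decays with rate `1 - ρ`. -/
lemma IsFrequencySolution.factor {U V : ℝ → L2 n} (h : IsFrequencySolution U V)
    {χ ρ : Space n → ℝ} (hχ : BddMeasurable χ)
    (hχ2 : BddMeasurable (fun ξ => χ ξ * (1 + ‖ξ‖ ^ 2))) (hρ : BddMeasurable ρ)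
    (hχρ : ∀ ξ, χ ξ * symbol ξ = χ ξ * (ρ ξ * (1 - ρ ξ))) {t : ℝ} (ht : 0 ≤ t) :
    ∀ᵐ ξ, (χ ξ : ℂ) * (V t ξ + ρ ξ * U t ξ) =
      (Real.exp (-t * (1 - ρ ξ)) : ℂ) * (χ ξ * (V 0 ξ + ρ ξ * U 0 ξ)) := by
  have hρ' : BddMeasurable (fun ξ => 1 - ρ ξ) := by
    have : BddMeasurable (fun ξ => 1 + (-1) * ρ ξ) :=
      BddMeasurable.add ⟨measurable_const, 1, fun _ => by simp⟩ (hρ.const_mul (-1))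
    simpa only [neg_one_mul, ← sub_eq_add_neg] using this
  have hχρb := hχ.mul hρ
  set E : ℝ → L2 n := fun s => mulOp χ (V s) + mulOp (fun ξ => χ ξ * ρ ξ) (U s) with hE
  have hEae : ∀ s, E s =ᵐ[volume] fun ξ => (χ ξ : ℂ) * (V s ξ + ρ ξ * U s ξ) := fun s => by
    filter_upwards [Lp.coeFn_add (mulOp χ (V s)) (mulOp (fun ξ => χ ξ * ρ ξ) (U s)),
      coeFn_mulOp hχ (V s), coeFn_mulOp hχρb (U s)] with ξ h1 h2 h3
    rw [hE, h1, Pi.add_apply, h2, h3]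
    push_cast; ring
  have hEd : ∀ s, 0 ≤ s → HasDerivWithinAt E (-mulOp (fun ξ => 1 - ρ ξ) (E s)) (Ici 0) s := by
    intro s hs
    refine ((h.2 χ hχ hχ2 s hs).add
      ((mulOp _).hasFDerivAt.comp_hasDerivWithinAt s (h.1 s hs))).congr_deriv ?_
    -- With `a = ρ(1-ρ)`, `-aU - V + ρV = -(1-ρ)(V + ρU)`.
    have e1 : (fun ξ => χ ξ * symbol ξ) = fun ξ => (1 - ρ ξ) * (χ ξ * ρ ξ) := by
      funext ξ; rw [hχρ]; ring
    have e2 : χ = fun ξ => (1 - ρ ξ) * χ ξ + χ ξ * ρ ξ := by funext ξ; ring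
    have e3 : mulOp χ (V s) = mulOp (fun ξ => (1 - ρ ξ) * χ ξ) (V s) +
        mulOp (fun ξ => χ ξ * ρ ξ) (V s) := by
      conv_lhs => rw [e2]
      exact mulOp_add (hρ'.mul hχ) hχρb _
    rw [e1, e3, hE, map_add, mulOp_mulOp hρ' hχ, mulOp_mulOp hρ' hχρb]
    abel
  have hsol := eq_mulOp_exp_of_hasDerivWithinAt hρ' hEd ht
  have hexp : BddMeasurable (fun ξ => Real.exp (-t * (1 - ρ ξ))) := (hρ'.const_mul (-t)).exp
  filter_upwards [hEae t, hEae 0, coeFn_mulOp hexp (E 0)] with ξ h1 h2 h3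
  rw [← h1, ← h2, ← h3, hsol]

/-- The smaller root of `ρ(1 - ρ) = 4π²|ξ|²` at low frequency. -/
def slowRoot (ξ : Space n) : ℝ := (1 - Real.sqrt (1 - 4 * min (symbol ξ) (1 / 8))) / 2

/-- The truncation at 1/8 keeps the argument of the root in `[1/2, 1]` at every frequency, so
`slowRoot` is a global bounded multiplier. -/
lemma bddMeasurable_slowRoot : BddMeasurable (slowRoot : Space n → ℝ) := by
  have hm := measurable_symbol (n := n)
  refine ⟨by unfold slowRoot; fun_prop, 1, fun ξ => ?_⟩
  have h1 : Real.sqrt (1 - 4 * min (symbol ξ) (1 / 8)) ≤ 1 := by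
    refine Real.sqrt_le_one.2 ?_
    have := le_min (symbol_nonneg ξ) (by norm_num : (0 : ℝ) ≤ 1 / 8)
    linarith
  have h0 := Real.sqrt_nonneg (1 - 4 * min (symbol ξ) (1 / 8))
  unfold slowRoot
  rw [abs_of_nonneg (by linarith)]
  linarith

lemma slowRoot_spec {ξ : Space n} (h : symbol ξ ≤ 1 / 8) :
    0 ≤ slowRoot ξ ∧ slowRoot ξ ≤ 1 / 4 ∧ slowRoot ξ * (1 - slowRoot ξ) = symbol ξ := by
  have ha := symbol_nonneg ξ
  have hs := Real.sq_sqrt (by linarith : 0 ≤ 1 - 4 * symbol ξ)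
  have h0 := Real.sqrt_nonneg (1 - 4 * symbol ξ)
  unfold slowRoot
  rw [min_eq_left h]
  refine ⟨?_, ?_, ?_⟩ <;> nlinarith

/-- The explicit solution at low frequency. -/
lemma IsFrequencySolution.low_formula {U V : ℝ → L2 n} (h : IsFrequencySolution U V) {t : ℝ}
    (ht : 0 ≤ t) : ∀ᵐ ξ : Space n, symbol ξ ≤ 1 / 8 →
      (1 - 2 * slowRoot ξ : ℂ) * U t ξ =
        (Real.exp (-t * slowRoot ξ) : ℂ) * (V 0 ξ + (1 - slowRoot ξ) * U 0 ξ) -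
        (Real.exp (-t * (1 - slowRoot ξ)) : ℂ) * (V 0 ξ + slowRoot ξ * U 0 ξ) := by
  set S : Set (Space n) := {ξ | symbol ξ ≤ 1 / 8} with hS
  have hSm : MeasurableSet S := measurableSet_le measurable_symbol measurable_const
  set χ : Space n → ℝ := S.indicator 1 with hχd
  have hχ : BddMeasurable χ := by
    refine ⟨measurable_one.indicator hSm, 1, fun ξ => ?_⟩
    by_cases hξ : ξ ∈ S <;> simp [hχd, hξ]
  have hχ2 : BddMeasurable (fun ξ => χ ξ * (1 + ‖ξ‖ ^ 2)) :=
    hχ.mul_one_add_norm_sq (R := 1 / 8) fun ξ hξ =>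
      indicator_of_notMem (by simpa [hS] using hξ) _
  have hr := bddMeasurable_slowRoot (n := n)
  have hr' : BddMeasurable (fun ξ : Space n => 1 - slowRoot ξ) := by
    have : BddMeasurable (fun ξ : Space n => 1 + (-1) * slowRoot ξ) :=
      BddMeasurable.add ⟨measurable_const, 1, fun _ => by simp⟩ (hr.const_mul (-1))
    simpa only [neg_one_mul, ← sub_eq_add_neg] using this
  have hid : ∀ ξ, χ ξ * symbol ξ = χ ξ * (slowRoot ξ * (1 - slowRoot ξ)) := fun ξ => by
    by_cases hξ : ξ ∈ S
    · rw [(slowRoot_spec hξ).2.2]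
    · simp [hχd, hξ]
  -- The factorization is used with each of the two roots; subtracting the two identities eliminates
  -- `V t`.
  filter_upwards [h.factor hχ hχ2 hr hid ht, h.factor hχ hχ2 hr' (fun ξ => by rw [hid]; ring) ht]
    with ξ h1 h2 hξ
  have hχ1 : χ ξ = 1 := indicator_of_mem (show ξ ∈ S from hξ) _
  rw [hχ1] at h1 h2
  simp only [Complex.ofReal_one, one_mul, sub_sub_cancel, Complex.ofReal_sub] at h1 h2
  linear_combination h2 - h1

/-- Exponential decay of the high frequency part. -/
lemma IsFrequencySolution.high_decay {U V : ℝ → L2 n} (h : IsFrequencySolution U V) {t : ℝ}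
    (ht : 0 ≤ t) :
    eLpNorm ({ξ : Space n | 1 / 8 < symbol ξ}.indicator (U t)) 2 volume ≤
      ENNReal.ofReal (5 * Real.exp (-t / 30) * (‖U 0‖ + ‖V 0‖)) := by
  have hm := measurable_symbol (n := n)
  -- The cutoff `a ≤ R` makes every multiplier bounded. The estimate does not depend on `R`, so
  -- Fatou's lemma removes the cutoff.
  have bound : ∀ R : ℕ, eLpNorm ({ξ : Space n | 1 / 8 < symbol ξ ∧ symbol ξ ≤ R}.indicator (U t)) 2
      volume ≤ ENNReal.ofReal (5 * Real.exp (-t / 30) * (‖U 0‖ + ‖V 0‖)) := by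
    intro R
    set S : Set (Space n) := {ξ | 1 / 8 < symbol ξ ∧ symbol ξ ≤ R} with hS
    have hSm : MeasurableSet S :=
      (measurableSet_lt measurable_const hm).inter (measurableSet_le hm measurable_const)
    set χ : Space n → ℝ := S.indicator 1 with hχd
    set p : Space n → ℝ := S.indicator fun ξ => (Real.sqrt (symbol ξ))⁻¹ with hpd
    set b : Space n → ℝ := S.indicator fun ξ => Real.sqrt (symbol ξ) with hbd
    have hpos : ∀ ξ ∈ S, 0 < Real.sqrt (symbol ξ) := fun ξ hξ =>
      Real.sqrt_pos.2 (lt_trans (by norm_num) hξ.1)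
    have hχ1 : ∀ ξ, |χ ξ| ≤ 1 := fun ξ => by by_cases hξ : ξ ∈ S <;> simp [hχd, hξ]
    have hp3 : ∀ ξ, |p ξ| ≤ 3 := fun ξ => by
      by_cases hξ : ξ ∈ S
      · rw [hpd, indicator_of_mem hξ, abs_of_pos (inv_pos.2 (hpos ξ hξ))]
        refine inv_le_of_inv_le₀ (by norm_num) (Real.le_sqrt_of_sq_le ?_)
        exact le_trans (by norm_num) hξ.1.le
      · simp [hpd, hξ]
    have hχ : BddMeasurable χ := ⟨measurable_one.indicator hSm, 1, hχ1⟩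
    have hp : BddMeasurable p := ⟨(hm.sqrt.inv).indicator hSm, 3, hp3⟩
    have hb : BddMeasurable b := by
      refine ⟨hm.sqrt.indicator hSm, Real.sqrt R, fun ξ => ?_⟩
      by_cases hξ : ξ ∈ S
      · rw [hbd, indicator_of_mem hξ, abs_of_pos (hpos ξ hξ)]
        exact Real.sqrt_le_sqrt hξ.2
      · simp [hbd, hξ]
    have hp2 : BddMeasurable (fun ξ => p ξ * (1 + ‖ξ‖ ^ 2)) :=
      hp.mul_one_add_norm_sq (R := R) fun ξ hξ =>
        indicator_of_notMem (fun hmem => (not_lt.2 hmem.2) hξ) _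
    have e1 : (fun ξ => p ξ * symbol ξ) = fun ξ => b ξ * χ ξ := by
      funext ξ
      by_cases hξ : ξ ∈ S
      · simp only [hpd, hbd, hχd, indicator_of_mem hξ, Pi.one_apply, mul_one]
        rw [inv_mul_eq_iff_eq_mul₀ (hpos ξ hξ).ne', Real.mul_self_sqrt (symbol_nonneg ξ)]
      · simp [hpd, hbd, hξ]
    have e2 : (fun ξ => b ξ * p ξ) = χ := by
      funext ξ
      by_cases hξ : ξ ∈ S
      · simp only [hpd, hbd, hχd, indicator_of_mem hξ, Pi.one_apply,
          mul_inv_cancel₀ (hpos ξ hξ).ne']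
      · simp [hbd, hχd, hξ]
    have e3 : (fun ξ => p ξ * χ ξ) = p := by
      funext ξ
      by_cases hξ : ξ ∈ S <;> simp [hpd, hχd, hξ]
    -- Dividing the natural energy by `a` gives `X = V/√a`, `Y = U`, `W = U/√a`, so only `L²` norms
    -- of the data enter. Since `a > 1/8`, `1/√a ≤ 3`.
    have key := damped_system_decay (X := fun s => mulOp p (V s)) (Y := fun s => mulOp χ (U s))
      (W := fun s => mulOp p (U s)) (B := mulOp b) (inner_mulOp hb)
      (fun s => by
        have := norm_mulOp_apply_le hp hp3 (mulOp χ (U s))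
        rwa [mulOp_mulOp hp hχ, e3] at this)
      (fun s => by rw [mulOp_mulOp hb hp, e2])
      (fun s hs => (mulOp p).hasFDerivAt.comp_hasDerivWithinAt s (h.1 s hs))
      (fun s hs => by
        have := h.2 p hp hp2 s hs
        rwa [e1, ← mulOp_mulOp hb hχ] at this)
      (fun s hs => by
        have := (mulOp χ).hasFDerivAt.comp_hasDerivWithinAt s (h.1 s hs)
        rw [mulOp_mulOp hb hp, e2]
        exact this) ht
    have hnorm : ‖mulOp χ (U t)‖ ≤ 5 * Real.exp (-t / 30) * (‖U 0‖ + ‖V 0‖) := by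
      have h1 := norm_mulOp_apply_le hp hp3 (V 0)
      have h2 := norm_mulOp_apply_le hχ hχ1 (U 0)
      have hexp : Real.exp (-t / 15) = Real.exp (-t / 30) ^ 2 := by
        rw [← Real.exp_nat_mul]; congr 1; push_cast; ring
      refine le_of_sq_le_sq ?_ (by positivity)
      beta_reduce at key
      rw [hexp] at key
      have h3 := pow_le_pow_left₀ (norm_nonneg _) h1 2
      have h4 := pow_le_pow_left₀ (norm_nonneg _) h2 2
      have h5 : ‖mulOp p (V 0)‖ ^ 2 + ‖mulOp χ (U 0)‖ ^ 2 ≤ 9 * (‖U 0‖ + ‖V 0‖) ^ 2 := by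
        nlinarith [mul_nonneg (norm_nonneg (U 0)) (norm_nonneg (V 0)), sq_nonneg ‖U 0‖]
      have h6 := mul_le_mul_of_nonneg_left h5 (sq_nonneg (Real.exp (-t / 30)))
      have h7 : 0 ≤ Real.exp (-t / 30) ^ 2 * (‖U 0‖ + ‖V 0‖) ^ 2 := by positivity
      -- The factors 2 from the decay and 9 from the data give `18 ≤ 5²`.
      nlinarith [sq_nonneg ‖mulOp p (V t)‖]
    have hae : {ξ : Space n | 1 / 8 < symbol ξ ∧ symbol ξ ≤ R}.indicator (U t) =ᵐ[volume]
        mulOp χ (U t) := by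
      filter_upwards [coeFn_mulOp hχ (U t)] with ξ h1
      rw [h1]
      by_cases hξ : ξ ∈ S
      · rw [hχd, indicator_of_mem hξ, indicator_of_mem hξ]; simp
      · rw [hχd, indicator_of_notMem hξ, indicator_of_notMem hξ]; simp
    rw [eLpNorm_congr_ae hae, ← Lp.enorm_def, ← ofReal_norm]
    exact ENNReal.ofReal_le_ofReal hnorm
  refine (Lp.eLpNorm_lim_le_liminf_eLpNorm (f := fun R : ℕ =>
    {ξ : Space n | 1 / 8 < symbol ξ ∧ symbol ξ ≤ R}.indicator (U t)) (fun R => ?_) _ ?_).trans ?_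
  · exact (Lp.aestronglyMeasurable (U t)).indicator
      ((measurableSet_lt measurable_const hm).inter (measurableSet_le hm measurable_const))
  · refine Filter.Eventually.of_forall fun ξ => tendsto_const_nhds.congr' ?_
    obtain ⟨N, hN⟩ := exists_nat_ge (symbol ξ)
    filter_upwards [Filter.eventually_ge_atTop N] with R hR
    have : symbol ξ ≤ R := hN.trans (by exact_mod_cast hR)
    simp only [indicator, mem_ofPred_eq, this, and_true]
  · exact Filter.liminf_le_of_frequently_le' (Filter.Frequently.of_forall bound)

/-! ### Pointwise and `L²` bounds for the error terms -/

/-- Used with `w = √(at)`: writing `exp(-at) = exp(-at/4) exp(-3at/4)`, the second factor absorbs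
`w` and `w³`. The bounds follow from `exp y ≥ 1 + y + y²/2`. -/
lemma self_and_cube_le_exp (w : ℝ) :
    w ≤ 4 * Real.exp (3 * w ^ 2 / 4) ∧ w ^ 3 ≤ 4 * Real.exp (3 * w ^ 2 / 4) := by
  have h := Real.quadratic_le_exp_of_nonneg (by positivity : 0 ≤ 3 * w ^ 2 / 4)
  constructor
  · nlinarith [sq_nonneg (w - 1), sq_nonneg (w ^ 2)]
  · nlinarith [sq_nonneg (w ^ 2 - w), sq_nonneg w, sq_nonneg (w ^ 2)]

lemma low_frequency_bound {a ρ t r M : ℝ} {z v u P : ℂ} (ht : 0 < t) (hr : 0 ≤ r)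
    (hra : r ^ 2 = a) (ha : a ≤ 1 / 8) (hρ0 : 0 ≤ ρ) (hρ : ρ ≤ 1 / 4) (hρa : ρ * (1 - ρ) = a)
    (hz : (1 - 2 * ρ : ℂ) * z = (Real.exp (-t * ρ) : ℂ) * (v + (1 - ρ) * u) -
      (Real.exp (-t * (1 - ρ)) : ℂ) * (v + ρ * u))
    (hvu : ‖v + u‖ ≤ M) (hu : ‖u‖ ≤ M) (hP : ‖P‖ ≤ M) (hvuP : ‖v + u - P‖ ≤ r * M) :
    ‖z - P * (Real.exp (-a * t) : ℂ)‖ ≤ 64 * M / Real.sqrt t * Real.exp (-a * t / 4) +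
      2 * Real.exp (-t / 2) * (‖v‖ + ‖u‖) := by
  set e := Real.exp (-a * t) with he
  set A := Real.exp (-t * ρ) with hA
  set B := Real.exp (-t * (1 - ρ)) with hB
  set q := Real.sqrt t with hq
  have hq0 : 0 < q := Real.sqrt_pos.2 ht
  have hqt : q ^ 2 = t := Real.sq_sqrt ht.le
  have he0 : 0 < e := Real.exp_pos _
  have hA0 : 0 < A := Real.exp_pos _
  have hB0 : 0 < B := Real.exp_pos _
  have hM : 0 ≤ M := (norm_nonneg _).trans hu
  have hAe : A ≤ e := Real.exp_le_exp.2 (by nlinarith [mul_nonneg ht.le (sq_nonneg ρ)])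
  -- Here `ρ = a + ρ²`, and `1 - exp(-x) ≤ x`.
  have heA : e - A ≤ e * (ρ ^ 2 * t) := by
    have h1 : A = e * Real.exp (-(ρ ^ 2 * t)) := by
      rw [hA, he, ← Real.exp_add, ← hρa]; congr 1; ring
    have h2 := Real.one_sub_le_exp_neg (ρ ^ 2 * t)
    rw [h1]
    nlinarith
  have hB2 : B ≤ Real.exp (-t / 2) := Real.exp_le_exp.2 (by nlinarith)
  -- The five errors: slow root against `a`, data against mass, the normalization `1 - 2ρ`, the
  -- coefficient `1 - ρ` of `u`, and the fast mode.
  have hid : (1 - 2 * ρ : ℂ) * (z - P * (e : ℂ)) = -((e - A : ℝ) : ℂ) * (v + u) + e * (v + u - P) +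
      (2 * ρ * e : ℝ) * P - (A * ρ : ℝ) * u - (B : ℂ) * (v + (ρ : ℂ) * u) := by
    rw [mul_sub, hz]; push_cast; ring
  have hn : (1 - 2 * ρ) * ‖z - P * (e : ℂ)‖ ≤ (e - A) * M + e * (r * M) + 2 * ρ * e * M +
      A * ρ * M + B * (‖v‖ + ‖u‖) := by
    have h1 : (1 - 2 * ρ) * ‖z - P * (e : ℂ)‖ = ‖(1 - 2 * ρ : ℂ) * (z - P * (e : ℂ))‖ := by
      rw [norm_mul, show (1 - 2 * ρ : ℂ) = ((1 - 2 * ρ : ℝ) : ℂ) by push_cast; rfl,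
        Complex.norm_of_nonneg (by linarith)]
    have hvρ : ‖v + (ρ : ℂ) * u‖ ≤ ‖v‖ + ‖u‖ := by
      refine (norm_add_le _ _).trans ?_
      rw [norm_mul, Complex.norm_of_nonneg hρ0]
      nlinarith [norm_nonneg u]
    rw [h1, hid]
    refine (norm_sub_le _ _).trans (add_le_add ((norm_sub_le _ _).trans
      (add_le_add ((norm_add_le _ _).trans (add_le_add ((norm_add_le _ _).trans
        (add_le_add ?_ ?_)) ?_)) ?_)) ?_)
    · rw [norm_mul, norm_neg, Complex.norm_of_nonneg (by linarith)]
      exact mul_le_mul_of_nonneg_left hvu (by linarith)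
    · rw [norm_mul, Complex.norm_of_nonneg he0.le]; gcongr
    · rw [norm_mul, Complex.norm_of_nonneg (by positivity)]; gcongr
    · rw [norm_mul, Complex.norm_of_nonneg (by positivity)]; gcongr
    · rw [norm_mul, Complex.norm_of_nonneg hB0.le]; gcongr
  have hρa2 : 3 * ρ ≤ 4 * a := by nlinarith
  have hr2 : r ≤ 1 / 2 := by nlinarith
  have hρr : 3 * ρ ≤ 2 * r := by nlinarith
  have hρsq : ρ ^ 2 ≤ 4 * r ^ 4 := by nlinarith
  obtain ⟨hw1, hw3⟩ := self_and_cube_le_exp (r * q)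
  have heE : e * Real.exp (3 * (r * q) ^ 2 / 4) = Real.exp (-a * t / 4) := by
    rw [he, ← Real.exp_add, mul_pow, hra, hqt]; congr 1; ring
  -- In `3r`, one `r` comes from data against mass and `2r` from the two terms of order `ρ`. The
  -- constant needed is `4·4 + 3·4 = 28`; dividing by `1 - 2ρ ≥ 1/2` later doubles 32 to 64.
  have hmain : e * (ρ ^ 2 * t + 3 * r) ≤ 32 / q * Real.exp (-a * t / 4) := by
    rw [div_mul_eq_mul_div, le_div_iff₀ hq0, ← heE]
    have h1 : (ρ ^ 2 * t + 3 * r) * q ≤ 4 * (r * q) ^ 3 + 3 * (r * q) := by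
      have h2 : ρ ^ 2 * t * q ≤ 4 * r ^ 4 * t * q := by gcongr
      have h3 : 4 * r ^ 4 * t * q = 4 * r * (r * q) ^ 3 := by rw [← hqt]; ring
      have h4 : r * (r * q) ^ 3 ≤ 1 * (r * q) ^ 3 := by gcongr; linarith
      linarith
    have h5 : (ρ ^ 2 * t + 3 * r) * q ≤ 32 * Real.exp (3 * (r * q) ^ 2 / 4) := by
      linarith [Real.exp_pos (3 * (r * q) ^ 2 / 4)]
    have h6 := mul_le_mul_of_nonneg_left h5 he0.le
    linarith
  have h9 : (1 - 2 * ρ) * ‖z - P * (e : ℂ)‖ ≤ M * (32 / q * Real.exp (-a * t / 4)) +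
      Real.exp (-t / 2) * (‖v‖ + ‖u‖) := by
    have h1 : (e - A) * M ≤ e * (ρ ^ 2 * t) * M := by gcongr
    have h2 : 2 * ρ * e * M + A * ρ * M ≤ e * (2 * r) * M := by
      have h3 : A * ρ ≤ e * ρ := by gcongr
      have h4 := mul_le_mul_of_nonneg_left hρr he0.le
      have h5 : 2 * ρ * e + A * ρ ≤ e * (2 * r) := by linarith
      have h6 := mul_le_mul_of_nonneg_right h5 hM
      linarith
    have h3 := mul_le_mul_of_nonneg_left hmain hM
    have h4 : B * (‖v‖ + ‖u‖) ≤ Real.exp (-t / 2) * (‖v‖ + ‖u‖) := by gcongr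
    linarith
  have h10 : 64 * M / q * Real.exp (-a * t / 4) = 2 * (M * (32 / q * Real.exp (-a * t / 4))) := by
    ring
  have h11 : 1 / 2 * ‖z - P * (e : ℂ)‖ ≤ (1 - 2 * ρ) * ‖z - P * (e : ℂ)‖ := by
    gcongr; linarith
  linarith

lemma high_frequency_gauss_bound {a t M : ℝ} {P : ℂ} (ht : 0 < t) (ha : 1 / 8 < a)
    (hP : ‖P‖ ≤ M) :
    ‖P * (Real.exp (-a * t) : ℂ)‖ ≤ 64 * M / Real.sqrt t * Real.exp (-a * t / 4) := by
  have hq0 : 0 < Real.sqrt t := Real.sqrt_pos.2 ht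
  have hqt : Real.sqrt t ^ 2 = t := Real.sq_sqrt ht.le
  have hra : Real.sqrt a ^ 2 = a := Real.sq_sqrt (by linarith)
  have hr : 1 / 3 ≤ Real.sqrt a := Real.le_sqrt_of_sq_le (by linarith)
  have hM : 0 ≤ M := (norm_nonneg _).trans hP
  have heE : Real.exp (-a * t) * Real.exp (3 * (Real.sqrt a * Real.sqrt t) ^ 2 / 4) =
      Real.exp (-a * t / 4) := by
    rw [← Real.exp_add, mul_pow, hra, hqt]; congr 1; ring
  have hw := (self_and_cube_le_exp (Real.sqrt a * Real.sqrt t)).1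
  rw [norm_mul, Complex.norm_of_nonneg (Real.exp_pos _).le, div_mul_eq_mul_div, le_div_iff₀ hq0,
    ← heE]
  have h1 : Real.sqrt t ≤ 64 * Real.exp (3 * (Real.sqrt a * Real.sqrt t) ^ 2 / 4) := by nlinarith
  calc ‖P‖ * Real.exp (-a * t) * Real.sqrt t
      ≤ M * Real.exp (-a * t) * (64 * Real.exp (3 * (Real.sqrt a * Real.sqrt t) ^ 2 / 4)) := by gcongr
    _ = _ := by ring

/-- Raise `y ≤ exp y` at `y = t/(30s)` to the power `s`. -/
lemma exp_le_mul_rpow {s t : ℝ} (hs : 0 < s) (ht : 0 < t) :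
    Real.exp (-t / 30) ≤ (30 * s) ^ s * t ^ (-s) := by
  have h1 : t / (30 * s) ≤ Real.exp (t / (30 * s)) :=
    (by linarith : t / (30 * s) ≤ t / (30 * s) + 1).trans (Real.add_one_le_exp _)
  have h2 := Real.rpow_le_rpow (by positivity) h1 hs.le
  rw [← Real.exp_mul, Real.div_rpow ht.le (by positivity),
    show t / (30 * s) * s = t / 30 by field_simp, div_le_iff₀ (by positivity)] at h2
  rw [Real.rpow_neg ht.le, neg_div, Real.exp_neg, ← div_eq_mul_inv, inv_le_iff_one_le_mul₀
    (Real.exp_pos _), div_mul_eq_mul_div, le_div_iff₀ (by positivity)]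
  linarith

lemma integrable_exp_neg_mul_norm_sq {b : ℝ} (hb : 0 < b) :
    Integrable (fun x : Space n => Real.exp (-b * ‖x‖ ^ 2)) := by
  have := (GaussianFourier.integrable_cexp_neg_mul_sq_norm_add (b := b) (by simpa using hb) 0
    (0 : Space n)).norm
  refine this.congr (Filter.Eventually.of_forall fun x => ?_)
  beta_reduce
  rw [Complex.norm_exp]
  congr 1
  simp [← Complex.ofReal_pow, ← Complex.ofReal_mul, ← Complex.ofReal_neg]

lemma memLp_gaussKernel {t : ℝ} (ht : 0 < t) :
    MemLp (fun x : Space n => (gaussKernel t x : ℂ)) 2 volume := by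
  rw [memLp_two_iff_integrable_sq_norm (integrable_gaussKernel ht).aestronglyMeasurable]
  refine ((integrable_exp_neg_mul_norm_sq (n := n) (b := 1 / (2 * t)) (by positivity)).const_mul
    ((1 / (Real.sqrt (4 * Real.pi * t)) ^ n) ^ 2)).congr (Filter.Eventually.of_forall fun x => ?_)
  beta_reduce
  rw [Complex.norm_real, Real.norm_eq_abs, sq_abs, gaussKernel, mul_pow, ← Real.exp_nat_mul]
  congr 2
  push_cast; field_simp; ring

lemma eLpNorm_exp_symbol_le {t : ℝ} (ht : 0 < t) :
    eLpNorm (fun ξ : Space n => Real.exp (-symbol ξ * t / 4)) 2 volume ≤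
      ENNReal.ofReal (t ^ (-(n : ℝ) / 4)) := by
  have hb : 0 < 2 * Real.pi ^ 2 * t := by positivity
  have hsq : ∀ ξ : Space n, ‖Real.exp (-symbol ξ * t / 4)‖ ^ 2 =
      Real.exp (-(2 * Real.pi ^ 2 * t) * ‖ξ‖ ^ 2) := fun ξ => by
    rw [Real.norm_eq_abs, sq_abs, ← Real.exp_nat_mul, symbol]
    congr 1; push_cast; ring
  have hmem : MemLp (fun ξ : Space n => Real.exp (-symbol ξ * t / 4)) 2 volume := by
    rw [memLp_two_iff_integrable_sq_norm (by
      have := measurable_symbol (n := n)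
      exact Measurable.aestronglyMeasurable (by fun_prop))]
    simpa only [hsq] using integrable_exp_neg_mul_norm_sq hb
  rw [hmem.eLpNorm_eq_integral_rpow_norm (by norm_num) (by norm_num)]
  refine ENNReal.ofReal_le_ofReal ?_
  simp only [ENNReal.toReal_ofNat, Real.rpow_two, hsq]
  rw [GaussianFourier.integral_rexp_neg_mul_sq_norm hb, finrank_euclideanSpace_fin,
    ← Real.rpow_mul (by positivity)]
  -- The Gaussian integral is `(1/(2πt))^(n/2)`, and `2π ≥ 1`.
  have h1 : Real.pi / (2 * Real.pi ^ 2 * t) ≤ t⁻¹ := by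
    rw [div_le_iff₀ hb]
    have := Real.pi_gt_three
    field_simp
    nlinarith
  calc (Real.pi / (2 * Real.pi ^ 2 * t)) ^ ((n : ℝ) / 2 * 2⁻¹)
      ≤ t⁻¹ ^ ((n : ℝ) / 2 * 2⁻¹) := Real.rpow_le_rpow (by positivity) h1 (by positivity)
    _ = t ^ (-(n : ℝ) / 4) := by
      rw [Real.inv_rpow ht.le, ← Real.rpow_neg ht.le]; congr 1; ring

lemma fourier_sub_gauss_ae {t : ℝ} (ht : 0 < t) (f : L2 n) (P : ℂ) :
    (𝓕 (f - P • (memLp_gaussKernel ht).toLp) : L2 n) =ᵐ[volume]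
      fun ξ => (𝓕 f : L2 n) ξ - P * (Real.exp (-symbol ξ * t) : ℂ) := by
  set g : L2 n := (memLp_gaussKernel ht).toLp with hg
  have hgae := (memLp_gaussKernel (n := n) ht).coeFn_toLp
  have hgi : Integrable g := (integrable_gaussKernel ht).congr hgae.symm
  have hF : (𝓕 (f - P • g) : L2 n) = 𝓕 f - P • 𝓕 g := by
    change Lp.fourierTransformₗᵢ (Space n) ℂ (f - P • g) = _
    rw [map_sub, map_smul]; rfl
  rw [hF]
  filter_upwards [Lp.coeFn_sub (𝓕 f : L2 n) (P • 𝓕 g), Lp.coeFn_smul P (𝓕 g : L2 n),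
    coeFn_fourier_of_integrable hgi] with ξ h1 h2 h3
  rw [h1, Pi.sub_apply, h2, Pi.smul_apply, h3, smul_eq_mul]
  congr 2
  have : 𝓕 (g : Space n → ℂ) ξ = 𝓕 (fun x : Space n => (gaussKernel t x : ℂ)) ξ := by
    rw [Real.fourier_eq, Real.fourier_eq]
    refine integral_congr_ae ?_
    filter_upwards [hgae] with x hx
    rw [hg, hx]
  rw [this, fourier_gaussKernel ht, symbol]

lemma sqrt_symbol (ξ : Space n) : Real.sqrt (symbol ξ) = 2 * Real.pi * ‖ξ‖ := by
  have : symbol ξ = (2 * Real.pi * ‖ξ‖) ^ 2 := by unfold symbol; ring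
  rw [this, Real.sqrt_sq (by have := Real.pi_pos; positivity)]

/-- Pointwise bound in frequency for the difference between the solution and the diffusion
profile. -/
lemma IsFrequencySolution.sub_gauss_bound {U V : ℝ → L2 n} (h : IsFrequencySolution U V)
    {u₀ u₁ : L2 n} (hU : U 0 = 𝓕 u₀) (hV : V 0 = 𝓕 u₁) (h0 : MemWeightedL1 1 u₀)
    (h1 : MemWeightedL1 1 u₁) {t : ℝ} (ht : 0 < t) :
    ∀ᵐ ξ : Space n, ‖U t ξ - ((∫ y, u₀ y) + ∫ y, u₁ y) * (Real.exp (-symbol ξ * t) : ℂ)‖ ≤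
      64 * (weightedL1Norm 1 u₀ + weightedL1Norm 1 u₁) / Real.sqrt t *
        Real.exp (-symbol ξ * t / 4) + 2 * Real.exp (-t / 2) * (‖V 0 ξ‖ + ‖U 0 ξ‖) +
        ‖{ξ : Space n | 1 / 8 < symbol ξ}.indicator (U t) ξ‖ := by
  have hM0 := integral_norm_le_weightedL1Norm h0
  have hM1 := integral_norm_le_weightedL1Norm h1
  have hP : ‖(∫ y, u₀ y) + ∫ y, u₁ y‖ ≤ weightedL1Norm 1 u₀ + weightedL1Norm 1 u₁ :=
    (norm_add_le _ _).trans (add_le_add ((norm_integral_le_integral_norm _).trans hM0)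
      ((norm_integral_le_integral_norm _).trans hM1))
  have hM1' : 0 ≤ weightedL1Norm 1 u₁ :=
    (integral_nonneg fun _ => norm_nonneg _).trans hM1
  filter_upwards [h.low_formula ht.le, coeFn_fourier_of_integrable h0.1,
    coeFn_fourier_of_integrable h1.1] with ξ hlow hf0 hf1
  rw [← hU] at hf0
  rw [← hV] at hf1
  by_cases hξ : symbol ξ ≤ 1 / 8
  · obtain ⟨hs0, hs1, hs2⟩ := slowRoot_spec hξ
    rw [indicator_of_notMem (by simpa using hξ), norm_zero, add_zero]
    have hb0 := (norm_fourier_le_integral (f := u₀) ξ).trans hM0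
    have hb1 := (norm_fourier_le_integral (f := u₁) ξ).trans hM1
    refine low_frequency_bound ht (Real.sqrt_nonneg _) (Real.sq_sqrt (symbol_nonneg ξ)) hξ hs0 hs1
      hs2 (hlow hξ) ?_ ?_ hP ?_
    · rw [hf0, hf1]
      exact (norm_add_le _ _).trans (by linarith)
    · rw [hf0]; linarith
    · have hd0 := norm_fourier_sub_integral_le h0 ξ
      have hd1 := norm_fourier_sub_integral_le h1 ξ
      rw [hf0, hf1, sqrt_symbol, mul_add]
      refine le_trans (le_of_eq ?_) ((norm_add_le _ _).trans (add_le_add hd0 hd1))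
      congr 1; ring
  · have hξ' := not_le.1 hξ
    rw [indicator_of_mem (show ξ ∈ {ξ : Space n | 1 / 8 < symbol ξ} from hξ')]
    have := high_frequency_gauss_bound ht hξ' hP
    refine (norm_sub_le _ _).trans ?_
    have h2 : 0 ≤ 2 * Real.exp (-t / 2) * (‖V 0 ξ‖ + ‖U 0 ξ‖) := by positivity
    linarith

end DampedWave

end

/-! ### Assembly of the estimate -/

open DampedWave FourierTransform in
theorem theorem1p2 (n : ℕ) (hn : 1 ≤ n) :
    ∃ C : ℝ, 0 < C ∧
      ∀ (u₀ : DampedWave.H1 n) (u₁ : DampedWave.L2 n),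
        DampedWave.MemWeightedL1 1 u₀.toL2 → DampedWave.MemWeightedL1 1 u₁ →
        ∀ u : ℝ → DampedWave.H1 n, DampedWave.IsWeakSolution u₀ u₁ u →
        ∀ t : ℝ, 0 < t →
          eLpNorm (fun x : DampedWave.Space n =>
              (u t).toL2 x - ((∫ y, u₀.toL2 y) + ∫ y, u₁ y) * (DampedWave.gaussKernel t x : ℂ))
            2 volume ≤
          ENNReal.ofReal (C * t ^ (-(n : ℝ) / 4 - 1 / 2) *
            (DampedWave.weightedL1Norm 1 u₀.toL2 + DampedWave.weightedL1Norm 1 u₁ +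
              ‖u₀.toL2‖ + ‖u₀.grad‖ + ‖u₁‖)) := by
  have hs : 0 < (n : ℝ) / 4 + 1 / 2 := by positivity
  set K : ℝ := (30 * ((n : ℝ) / 4 + 1 / 2)) ^ ((n : ℝ) / 4 + 1 / 2) with hK
  have hK0 : 0 < K := by positivity
  -- The 64 is the diffusive error; `7K = 2K + 5K` collects the fast mode and the high frequencies,
  -- their exponentials being bounded by `K τ`.
  refine ⟨64 + 7 * K, by positivity, fun u₀ u₁ h0 h1 u hu t ht => ?_⟩
  obtain ⟨V, hV0, hUd, hVd⟩ := hu.exists_fourier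
  set U : ℝ → L2 n := fun s => 𝓕 (u s).toL2 with hU
  have hU0 : U 0 = 𝓕 u₀.toL2 := by simp only [hU, hu.2.1]
  have hsol : IsFrequencySolution U V := ⟨hUd, hVd⟩
  set P : ℂ := (∫ y, u₀.toL2 y) + ∫ y, u₁ y with hP
  set M : ℝ := weightedL1Norm 1 u₀.toL2 + weightedL1Norm 1 u₁ with hM
  have hM0 : 0 ≤ M := add_nonneg
    (integral_nonneg fun x => by positivity) (integral_nonneg fun x => by positivity)
  set w : L2 n := (u t).toL2 - P • (memLp_gaussKernel ht).toLp with hw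
  set τ : ℝ := t ^ (-(n : ℝ) / 4 - 1 / 2) with hτ
  have hτ0 : 0 < τ := Real.rpow_pos_of_pos ht _
  have hexp : Real.exp (-t / 30) ≤ K * τ := by
    have := exp_le_mul_rpow hs ht
    rwa [show -((n : ℝ) / 4 + 1 / 2) = -(n : ℝ) / 4 - 1 / 2 by ring] at this
  have hw1 : eLpNorm (fun x => (u t).toL2 x - P * (gaussKernel t x : ℂ)) 2 volume =
      eLpNorm (𝓕 w : L2 n) 2 volume := by
    rw [← Lp.enorm_def, ← ofReal_norm, Lp.norm_fourier_eq, ofReal_norm, Lp.enorm_def]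
    refine eLpNorm_congr_ae ?_
    filter_upwards [Lp.coeFn_sub (u t).toL2 (P • (memLp_gaussKernel ht).toLp),
      Lp.coeFn_smul P ((memLp_gaussKernel (n := n) ht).toLp),
      (memLp_gaussKernel (n := n) ht).coeFn_toLp] with x e1 e2 e3
    rw [hw, e1, Pi.sub_apply, e2, Pi.smul_apply, e3, smul_eq_mul]
  have b1 : eLpNorm (fun ξ : Space n => 64 * M / Real.sqrt t * Real.exp (-symbol ξ * t / 4)) 2
      volume ≤ ENNReal.ofReal (64 * M * τ) := by
    have hc : (fun ξ : Space n => 64 * M / Real.sqrt t * Real.exp (-symbol ξ * t / 4)) =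
        (64 * M / Real.sqrt t) • fun ξ : Space n => Real.exp (-symbol ξ * t / 4) := rfl
    have hτ' : 64 * M * τ = 64 * M / Real.sqrt t * t ^ (-(n : ℝ) / 4) := by
      rw [hτ, sub_eq_add_neg, Real.rpow_add ht, Real.rpow_neg ht.le (1 / 2), ← Real.sqrt_eq_rpow]
      ring
    rw [hc, eLpNorm_const_smul, Real.enorm_of_nonneg (by positivity), hτ',
      ENNReal.ofReal_mul (by positivity)]
    gcongr
    exact eLpNorm_exp_symbol_le ht
  have b2 : eLpNorm (fun ξ : Space n => 2 * Real.exp (-t / 2) * (‖V 0 ξ‖ + ‖U 0 ξ‖)) 2 volume ≤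
      ENNReal.ofReal (2 * (K * τ) * (‖u₁‖ + ‖u₀.toL2‖)) := by
    have hc : (fun ξ : Space n => 2 * Real.exp (-t / 2) * (‖V 0 ξ‖ + ‖U 0 ξ‖)) =
        (2 * Real.exp (-t / 2)) • ((fun ξ : Space n => ‖V 0 ξ‖) + fun ξ => ‖U 0 ξ‖) := rfl
    have hle : eLpNorm ((fun ξ : Space n => ‖V 0 ξ‖) + fun ξ => ‖U 0 ξ‖) 2 volume ≤
        ENNReal.ofReal (‖u₁‖ + ‖u₀.toL2‖) := by
      refine (eLpNorm_add_le (Lp.aestronglyMeasurable (V 0)).norm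
        (Lp.aestronglyMeasurable (U 0)).norm (by norm_num)).trans (le_of_eq ?_)
      rw [eLpNorm_norm, eLpNorm_norm, ← Lp.enorm_def, ← Lp.enorm_def, ← ofReal_norm, ← ofReal_norm,
        hV0, hU0, Lp.norm_fourier_eq, Lp.norm_fourier_eq,
        ENNReal.ofReal_add (norm_nonneg _) (norm_nonneg _)]
    rw [hc, eLpNorm_const_smul, Real.enorm_of_nonneg (by positivity),
      ENNReal.ofReal_mul (p := 2 * (K * τ)) (by positivity)]
    refine mul_le_mul' (ENNReal.ofReal_le_ofReal ?_) hle
    linarith [(Real.exp_le_exp.2 (by linarith : -t / 2 ≤ -t / 30)).trans hexp]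
  have b3 : eLpNorm (fun ξ : Space n => ‖{ξ : Space n | 1 / 8 < symbol ξ}.indicator (U t) ξ‖) 2
      volume ≤ ENNReal.ofReal (5 * (K * τ) * (‖u₀.toL2‖ + ‖u₁‖)) := by
    rw [eLpNorm_norm]
    refine (hsol.high_decay ht.le).trans (ENNReal.ofReal_le_ofReal ?_)
    rw [hU0, hV0, Lp.norm_fourier_eq, Lp.norm_fourier_eq]
    exact mul_le_mul_of_nonneg_right (by linarith) (by positivity)
  have hms := measurable_symbol (n := n)
  have m1 : AEStronglyMeasurable
      (fun ξ : Space n => 64 * M / Real.sqrt t * Real.exp (-symbol ξ * t / 4)) volume :=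
    Measurable.aestronglyMeasurable (by fun_prop)
  have m2 : AEStronglyMeasurable
      (fun ξ : Space n => 2 * Real.exp (-t / 2) * (‖V 0 ξ‖ + ‖U 0 ξ‖)) volume :=
    ((Lp.aestronglyMeasurable (V 0)).norm.add (Lp.aestronglyMeasurable (U 0)).norm).const_mul _
  have m3 : AEStronglyMeasurable
      (fun ξ : Space n => ‖{ξ : Space n | 1 / 8 < symbol ξ}.indicator (U t) ξ‖) volume :=
    ((Lp.aestronglyMeasurable (U t)).indicator (measurableSet_lt measurable_const hms)).norm
  rw [hw1]
  refine (eLpNorm_mono_ae_real (g := (fun ξ : Space n => 64 * M / Real.sqrt t *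
    Real.exp (-symbol ξ * t / 4)) + (fun ξ => 2 * Real.exp (-t / 2) * (‖V 0 ξ‖ + ‖U 0 ξ‖)) +
    fun ξ => ‖{ξ : Space n | 1 / 8 < symbol ξ}.indicator (U t) ξ‖) ?_).trans ?_
  · filter_upwards [fourier_sub_gauss_ae ht (u t).toL2 P,
      hsol.sub_gauss_bound hU0 hV0 h0 h1 ht] with ξ e1 e2
    rw [hw, e1]
    exact e2
  · refine (eLpNorm_add_le (m1.add m2) m3 (by norm_num)).trans
      ((add_le_add ((eLpNorm_add_le m1 m2 (by norm_num)).trans (add_le_add b1 b2)) b3).trans ?_)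
    rw [← ENNReal.ofReal_add (by positivity) (by positivity),
      ← ENNReal.ofReal_add (by positivity) (by positivity)]
    refine ENNReal.ofReal_le_ofReal ?_
    have e1 : 0 ≤ K * τ * M := by positivity
    have e2 : 0 ≤ τ * (‖u₀.toL2‖ + ‖u₁‖) := by positivity
    have e3 : 0 ≤ (64 + 7 * K) * τ * ‖u₀.grad‖ := by positivity
    linarith
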